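/- **Setting.** Let $d,T\ge 1$ be integers, $\delta\in(0,1)$, $\epsilon,\eta,C_0,L_0,L_1>0$, $B,C\ge 0$. Let $f:\mathbb R^d\to\mathbb R$ be differentiable and $(L_0,L_1)$-smooth, i.e. $\|\nabla f(y)-\nabla f(x)\|\le (L_0+L_1\|\nabla f(x)\|)\|x-y\|$ whenever $\|x-y\|\le 1/L_1$, and let $f^*\in\mathbb R$ satisfy $f\ge f^*$ on $\mathbb R^d$. Let $z_1,\dots,z_T$ be independent samples with a common law $P$, and let $g(x,z)\in\mathbb R^d$ be a (jointly measurable) gradient oracle such that for every $x\in\mathbb R^d$ one has $\mathbb E_{z\sim P}[g(x,z)]=\nabla f(x)$ and, for $P$-almost every $z$, $\|g(x,z)-\nabla f(x)\|^2\le B\|\nabla f(x)\|^2+C$. AdaGrad (without momentum) starts from a given $x_1\in\mathbb R^d$ and $v_0=0$ and iterates, for $s=1,\dots,T$ and with coordinate-wise operations, $$g_s=g(x_s,z_s),\qquad v_s=v_{s-1}+g_s^2,\qquad x_{s+1}=x_s-\eta\,\frac{g_s}{\sqrt{v_s}+\epsilon}.$$ Put $\Delta_1=f(x_1)-f^*$,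 $G=\|\nabla f(x_1)\|$ and $$\tilde{\mathcal J}=1+\frac1{\epsilon^2}\left[2(B+1)\left(G+C_0\sqrt d\,T\right)^2T+2CT\right],$$ $$\Lambda_y=\Delta_1+3C_0\log\frac T\delta+\left(C_0d+\tfrac32C_0^2d\right)\log\tilde{\mathcal J},\qquad \Lambda_x=(2L_0+1)\Lambda_y+8L_1\Lambda_y^2+C_0^2d\log\tilde{\mathcal J},$$ $$\mathcal H=\sqrt{2(B+1)\left(4L_1\Lambda_x+\sqrt{4L_0\Lambda_x}\right)^2+2C},\qquad \mathcal L=2L_0+2L_1\left(4L_1\Lambda_x+\sqrt{4L_0\Lambda_x}\right).$$ **Convergence bound.** If $\eta\le\min\left\{C_0,\ \frac{C_0}{\mathcal H},\ \frac{C_0}{\mathcal L},\ \frac1{L_1\sqrt d}\right\}$, then with probability at least $1-\delta$, $$\frac1T\sum_{s=1}^T\|\nabla f(x_s)\|^2\le\frac{4\Lambda_y}{\eta}\left(\frac{2\Lambda_y(B+1)/\eta+\mathcal H+\epsilon}{T}+\sqrt{\frac{2C}{T}}\right).$$ **Order of the constants** (here $\Lambda_y$, $\Lambda_x$ are regarded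 as functions of the parameters, with $\Delta_1,G\ge 0$ arbitrary). (a) There is a universal constant $c>0$ such that always $$\Lambda_y\le c\left(\Delta_1+(C_0^2d+C_0d)\left[\log\left(\frac T\delta+\frac T{\epsilon^2}\right)+\log\left(1+(B+1)(G^2+C_0^2d)+C\right)\right]\right).$$ (b) There are constants $k,K>0$ depending only on $d,B,C,C_0,G$ such that for all $T\ge1$, $\delta\in(0,1)$, $\epsilon>0$, $\Delta_1\ge0$, $$k\left(\Delta_1+C_0^2d\log\left(\frac T\delta+\frac T{\epsilon^2}\right)\right)\le\Lambda_y\le K\left(\Delta_1+C_0^2d\log\left(\frac T\delta+\frac T{\epsilon^2}\right)\right).$$ (c) There are constants $k',K'>0$ depending only on $L_0,L_1,C_0$ such that always $k'\Lambda_y^2\le\Lambda_x\le K'(\Lambda_y+\Lambda_y^2)$, and $\Lambda_x\le K'\Lambda_y^2$ whenever $T\ge2$. -/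

import Mathlib

open MeasureTheory ProbabilityTheory

noncomputable section

namespace AdaGrad

/-- The state of the algorithm: current point, momentum vector, accumulated squared gradients. -/
structure State (d : ℕ) where
  x : EuclideanSpace ℝ (Fin d)
  m : EuclideanSpace ℝ (Fin d)
  v : EuclideanSpace ℝ (Fin d)

/-- One iteration of (coordinate-wise) AdaGrad with heavy-ball momentum on the sample `z`:
`g_s = g(x_s, z_s)`, `v_s = v_{s-1} + g_s²`, `m_s = β m_{s-1} - η g_s / (√v_s + ε)`,
`x_{s+1} = x_s + m_s`, all operations on vectors being coordinate-wise. -/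
def step {d : ℕ} {Z : Type*} (g : EuclideanSpace ℝ (Fin d) → Z → EuclideanSpace ℝ (Fin d))
    (β η ε : ℝ) (z : Z) (S : State d) : State d :=
  let gs : EuclideanSpace ℝ (Fin d) := g S.x z
  let v' : EuclideanSpace ℝ (Fin d) := WithLp.toLp 2 fun i => S.v i + gs i ^ 2
  let m' : EuclideanSpace ℝ (Fin d) :=
    WithLp.toLp 2 fun i => β * S.m i - η * gs i / (Real.sqrt (v' i) + ε)
  { x := S.x + m', m := m', v := v' }

/-- The state `(x_{s+1}, m_s, v_s)` after `s` iterations, on the samples `z 1, …, z s`,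
from `(x₁, m₀, v₀) = (x₁, 0, 0)`. -/
def state {d : ℕ} {Z : Type*} (g : EuclideanSpace ℝ (Fin d) → Z → EuclideanSpace ℝ (Fin d))
    (β η ε : ℝ) (x₁ : EuclideanSpace ℝ (Fin d)) (z : ℕ → Z) : ℕ → State d
  | 0 => { x := x₁, m := 0, v := 0 }
  | s + 1 => step g β η ε (z (s + 1)) (state g β η ε x₁ z s)

/-- The iterate `x_s`, for `s ≥ 1`; it depends on the samples `z 1, …, z (s - 1)` only. -/
def iterate {d : ℕ} {Z : Type*} (g : EuclideanSpace ℝ (Fin d) → Z → EuclideanSpace ℝ (Fin d))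
    (β η ε : ℝ) (x₁ : EuclideanSpace ℝ (Fin d)) (z : ℕ → Z) (s : ℕ) :
    EuclideanSpace ℝ (Fin d) :=
  (state g β η ε x₁ z (s - 1)).x

/-- `(L₀, L₁)`-smoothness of a differentiable function. -/
def GeneralizedSmooth {d : ℕ} (f : EuclideanSpace ℝ (Fin d) → ℝ) (L₀ L₁ : ℝ) : Prop :=
  Differentiable ℝ f ∧
    ∀ x y : EuclideanSpace ℝ (Fin d), ‖x - y‖ ≤ 1 / L₁ →
      ‖gradient f y - gradient f x‖ ≤ (L₀ + L₁ * ‖gradient f x‖) * ‖x - y‖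

/-- (A1): `fstar` is a lower bound of `f`. -/
def BoundedBelowBy {d : ℕ} (f : EuclideanSpace ℝ (Fin d) → ℝ) (fstar : ℝ) : Prop :=
  ∀ x, fstar ≤ f x

/-- (A2): `g(x, z)`, with `z` of law `P`, is an unbiased estimator of `∇f(x)` for every `x`. -/
def UnbiasedOracle {d : ℕ} {Z : Type*} [MeasurableSpace Z]
    (f : EuclideanSpace ℝ (Fin d) → ℝ)
    (g : EuclideanSpace ℝ (Fin d) → Z → EuclideanSpace ℝ (Fin d)) (P : Measure Z) : Prop :=
  ∀ x, Integrable (g x) P ∧ ∫ z, g x z ∂P = gradient f x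

/-- (A3): relaxed almost surely affine variance noise with constants `A, B, C`. -/
def RelaxedAffineNoise {d : ℕ} {Z : Type*} [MeasurableSpace Z]
    (f : EuclideanSpace ℝ (Fin d) → ℝ) (fstar : ℝ)
    (g : EuclideanSpace ℝ (Fin d) → Z → EuclideanSpace ℝ (Fin d)) (P : Measure Z)
    (A B C : ℝ) : Prop :=
  ∀ x, ∀ᵐ z ∂P,
    ‖g x z - gradient f x‖ ^ 2 ≤ A * (f x - fstar) + B * ‖gradient f x‖ ^ 2 + C

/-- The polynomial inside the logarithms of `Λ_y` and `Λ_x`, for `β = 0` and `A = 0`;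
`G` stands for `‖∇f(x₁)‖`. -/
def polyJ (d T : ℕ) (B C C₀ ε G : ℝ) : ℝ :=
  1 + 1 / ε ^ 2 *
    (2 * (B + 1) * (G + C₀ * Real.sqrt d * T) ^ 2 * T + 2 * C * T)

/-- `Λ_y` for `β = 0` and `A = 0`; `Δ₁` stands for `f(x₁) - f*` and `G` for `‖∇f(x₁)‖`. -/
def LambdaY (d T : ℕ) (B C C₀ ε δ Δ₁ G : ℝ) : ℝ :=
  Δ₁ + 3 * C₀ * Real.log (T / δ) + C₀ * d * Real.log (polyJ d T B C C₀ ε G)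
    + C₀ ^ 2 * d / 2 * Real.log (polyJ d T B C C₀ ε G)
    + (C₀ ^ 2 * d / 2 + C₀ ^ 2 * d / 2) * Real.log (polyJ d T B C C₀ ε G)

/-- `Λ_x` for `β = 0` and `A = 0`. -/
def LambdaX (d T : ℕ) (L₀ L₁ B C C₀ ε δ Δ₁ G : ℝ) : ℝ :=
  (2 * L₀ + 1) * LambdaY d T B C C₀ ε δ Δ₁ G
    + 8 * L₁ * LambdaY d T B C C₀ ε δ Δ₁ G ^ 2
    + C₀ ^ 2 * d * Real.log (polyJ d T B C C₀ ε G)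

/-- The constant `𝓗`, as a function of `Λ_x`. -/
def calH (L₀ L₁ A B C Λx : ℝ) : ℝ :=
  Real.sqrt (2 * A * Λx + 2 * (B + 1) * (4 * L₁ * Λx + Real.sqrt (4 * L₀ * Λx)) ^ 2 + 2 * C)

/-- The constant `𝓛`, as a function of `Λ_x`. -/
def calL (L₀ L₁ Λx : ℝ) : ℝ :=
  2 * L₀ + 2 * L₁ * (4 * L₁ * Λx + Real.sqrt (4 * L₀ * Λx))

end AdaGrad

end

/-!
The stochastic gradient `g_s` enters both the numerator and the denominator of the AdaGrad step, so
the conditional mean of the step is not explicit. By the affine bound on the noise, `|g_s|` is at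
most `r = √(2 (B + 1) ‖∇f(x_s)‖² + 2 C)`, and the denominator `√v_s + ε` can be traded for the
predictable one `√(v_{s-1} + r²) + ε`, up to an error of `r` times the squared normalized step.
The squared normalized steps are dominated by the increments of `log (v_s + ε²)`, so they telescope
to `d log 𝒥`.

What remains of the descent inequality is a sum of noise terms, of mean zero given the past and of
square at most `r W_s`, where `W_s` is the squared norm of `∇f(x_s)` in the predictable weights. By
Hoeffding's lemma the compensated sum is the logarithm of an exponential supermartingale; Markov's
inequality and a union bound over the `T` times cost `log (T / δ)`, and since `η r ≤ C₀` the
compensator is absorbed into the decrease `η W_s`.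

The bound `η r ≤ C₀` is itself a consequence of the conclusion: `(L₀, L₁)`-smoothness bounds
`‖∇f(x)‖` in terms of `f(x) - f*`, hence as long as `f(x_s) - f* ≤ Λ_x` the step size is small
enough for one more step, and `f(x_s) - f* ≤ Λ_y ≤ Λ_x` follows by induction on `s`.
-/

noncomputable section

namespace AdaGrad

theorem le_add_sqrt_of_sq_le_mul_add {a b x : ℝ} (ha : 0 ≤ a) (hb : 0 ≤ b)
    (h : x ^ 2 ≤ a * x + b) : x ≤ a + √b := by
  by_contra! hlt
  nlinarith [Real.sqrt_nonneg b, Real.sq_sqrt hb, mul_nonneg ha (Real.sqrt_nonneg b)]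

section Smoothness

section Descent

variable {E : Type*} [NormedAddCommGroup E] [InnerProductSpace ℝ E] [CompleteSpace E]

theorem hasDerivAt_comp_add_smul {f : E → ℝ} {x u : E} {t : ℝ}
    (hf : DifferentiableAt ℝ f (x + t • u)) :
    HasDerivAt (fun t : ℝ => f (x + t • u)) (inner ℝ (gradient f (x + t • u)) u) t := by
  have hline : HasDerivAt (fun t : ℝ => x + t • u) u t := by
    simpa using ((hasDerivAt_id t).smul_const u).const_add x
  rw [inner_gradient_left]
  exact hf.hasFDerivAt.comp_hasDerivAt t hline

theorem le_add_inner_add_sq_of_norm_gradient_sub_le {f : E → ℝ} (hf : Differentiable ℝ f)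
    {x u : E} {K : ℝ}
    (h : ∀ t ∈ Set.Ioo (0 : ℝ) 1, ‖gradient f (x + t • u) - gradient f x‖ ≤ K * (t * ‖u‖)) :
    f (x + u) ≤ f x + inner ℝ (gradient f x) u + K / 2 * ‖u‖ ^ 2 := by
  let φ : ℝ → ℝ := fun t =>
    f (x + t • u) - t * inner ℝ (gradient f x) u - t ^ 2 * (K / 2 * ‖u‖ ^ 2)
  have hφ (t : ℝ) : HasDerivAt φ (inner ℝ (gradient f (x + t • u)) u
      - inner ℝ (gradient f x) u - 2 * t * (K / 2 * ‖u‖ ^ 2)) t := by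
    convert! ((hasDerivAt_comp_add_smul (hf _)).sub
      ((hasDerivAt_id t).mul_const (inner ℝ (gradient f x) u))).sub
      ((hasDerivAt_pow 2 t).mul_const (K / 2 * ‖u‖ ^ 2)) using 1
    simp
  have hanti : AntitoneOn φ (Set.Icc 0 1) := by
    refine antitoneOn_of_deriv_nonpos (convex_Icc 0 1)
      (fun t _ => (hφ t).continuousAt.continuousWithinAt)
      (fun t _ => (hφ t).differentiableAt.differentiableWithinAt) fun t ht => ?_
    rw [interior_Icc] at ht
    rw [(hφ t).deriv, ← inner_sub_left]
    have := (real_inner_le_norm (gradient f (x + t • u) - gradient f x) u).trans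
      (mul_le_mul_of_nonneg_right (h t ht) (norm_nonneg u))
    linarith
  have hφ01 : φ 1 ≤ φ 0 :=
    hanti (Set.left_mem_Icc.2 zero_le_one) (Set.right_mem_Icc.2 zero_le_one) zero_le_one
  simp only [φ, one_smul, zero_smul, add_zero] at hφ01
  linarith

end Descent

variable {d : ℕ} {f : EuclideanSpace ℝ (Fin d) → ℝ} {L₀ L₁ : ℝ}

theorem GeneralizedSmooth.le_add_inner_add_sq (hf : GeneralizedSmooth f L₀ L₁)
    (x u : EuclideanSpace ℝ (Fin d)) (hu : ‖u‖ ≤ 1 / L₁) :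
    f (x + u) ≤ f x + inner ℝ (gradient f x) u
      + (L₀ + L₁ * ‖gradient f x‖) / 2 * ‖u‖ ^ 2 := by
  refine le_add_inner_add_sq_of_norm_gradient_sub_le hf.1 fun t ht => ?_
  have hnorm : ‖x - (x + t • u)‖ = t * ‖u‖ := by
    rw [sub_add_cancel_left, norm_neg, norm_smul, Real.norm_of_nonneg ht.1.le]
  rw [← hnorm]
  refine hf.2 x (x + t • u) ?_
  rw [hnorm]
  exact (mul_le_of_le_one_left (norm_nonneg u) ht.2.le).trans hu

theorem GeneralizedSmooth.continuous_gradient (hf : GeneralizedSmooth f L₀ L₁) (hL₁ : 0 < L₁) :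
    Continuous (gradient f) := by
  refine continuous_iff_continuousAt.2 fun x => tendsto_iff_norm_sub_tendsto_zero.2 ?_
  have hmajorant : Filter.Tendsto (fun y => (L₀ + L₁ * ‖gradient f x‖) * ‖x - y‖)
      (nhds x) (nhds 0) := by
    have : Continuous fun y => (L₀ + L₁ * ‖gradient f x‖) * ‖x - y‖ := by fun_prop
    simpa using this.tendsto x
  refine squeeze_zero' (Filter.Eventually.of_forall fun _ => norm_nonneg _) ?_ hmajorant
  filter_upwards [Metric.closedBall_mem_nhds x (one_div_pos.2 hL₁)] with y hy
  exact hf.2 x y (mem_closedBall_iff_norm'.1 hy)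

theorem GeneralizedSmooth.sq_norm_gradient_le (hf : GeneralizedSmooth f L₀ L₁) (hL₀ : 0 < L₀)
    (hL₁ : 0 < L₁) {fstar : ℝ} (hb : BoundedBelowBy f fstar) (x : EuclideanSpace ℝ (Fin d)) :
    ‖gradient f x‖ ^ 2 ≤ 2 * (L₀ + L₁ * ‖gradient f x‖) * (f x - fstar) := by
  set N := ‖gradient f x‖ with hN
  set L := L₀ + L₁ * N with hL
  have hLpos : 0 < L := by positivity
  -- Descend along a gradient step of length `N / L`, which stays within the radius `1 / L₁`.
  let u : EuclideanSpace ℝ (Fin d) := -(1 / L) • gradient f x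
  have hu : ‖u‖ = N / L := by
    rw [norm_smul, norm_neg, Real.norm_of_nonneg (by positivity)]
    ring
  have hu_le : ‖u‖ ≤ 1 / L₁ := by
    rw [hu, div_le_div_iff₀ hLpos hL₁]
    linarith
  have hdescent := hf.le_add_inner_add_sq x u hu_le
  rw [hu, inner_smul_right, real_inner_self_eq_norm_sq, ← hN, ← hL] at hdescent
  have hstep : -(1 / L) * N ^ 2 + L / 2 * (N / L) ^ 2 = -(N ^ 2 / (2 * L)) := by
    field_simp
    ring
  have hgap : N ^ 2 / (2 * L) ≤ f x - fstar := by linarith [hb (x + u)]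
  rwa [div_le_iff₀' (by positivity)] at hgap

theorem GeneralizedSmooth.norm_gradient_le (hf : GeneralizedSmooth f L₀ L₁) (hL₀ : 0 < L₀)
    (hL₁ : 0 < L₁) {fstar Δ : ℝ} (hb : BoundedBelowBy f fstar)
    {x : EuclideanSpace ℝ (Fin d)} (hΔ : f x - fstar ≤ Δ) :
    ‖gradient f x‖ ≤ 4 * L₁ * Δ + √(4 * L₀ * Δ) := by
  have hΔ0 : 0 ≤ Δ := (sub_nonneg.2 (hb x)).trans hΔ
  have hsq := (hf.sq_norm_gradient_le hL₀ hL₁ hb x).trans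
    (mul_le_mul_of_nonneg_left hΔ (by positivity))
  refine le_add_sqrt_of_sq_le_mul_add (by positivity) (by positivity) (hsq.trans ?_)
  have : 0 ≤ L₁ * Δ * ‖gradient f x‖ := by positivity
  have : 0 ≤ L₀ * Δ := by positivity
  linarith

end Smoothness

section Orders

theorem log_one_add_mul_le_mul_log {K y : ℝ} (hK : 1 ≤ K) (hy : 0 ≤ y) :
    Real.log (1 + K * y) ≤ K * Real.log (1 + y) := by
  rw [← Real.log_rpow (by positivity)]
  exact Real.log_le_log (by positivity) (one_add_mul_self_le_rpow_one_add (by linarith) hK)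

theorem log_one_add_mul_le_add_log {a y : ℝ} (ha : 0 ≤ a) (hy : 0 ≤ y) :
    Real.log (1 + a * y) ≤ Real.log (1 + a) + Real.log (1 + y) := by
  rw [← Real.log_mul (by positivity) (by positivity)]
  exact Real.log_le_log (by positivity) (by linarith)

variable {d T : ℕ} {L₀ L₁ B C C₀ ε δ Δ₁ G : ℝ}

theorem log_div_pos (hT : 1 ≤ T) (hδ : 0 < δ) (hδ1 : δ < 1) : 0 < Real.log (T / δ) := by
  have hT' : (1 : ℝ) ≤ T := by exact_mod_cast hT
  exact Real.log_pos ((one_lt_div hδ).2 (hδ1.trans_le hT'))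

theorem log_div_le_log_div_add_div_sq (hT : 1 ≤ T) (hδ : 0 < δ) :
    Real.log (T / δ) ≤ Real.log (T / δ + T / ε ^ 2) :=
  Real.log_le_log (by positivity) (le_add_of_nonneg_right (by positivity))

theorem log_div_add_div_sq_le_add (hT : 1 ≤ T) (hδ : 0 < δ) (hδ1 : δ < 1) :
    Real.log (T / δ + T / ε ^ 2) ≤ Real.log (T / δ) + Real.log (1 + T / ε ^ 2) := by
  have hT' : (1 : ℝ) ≤ T := by exact_mod_cast hT
  have hTδ : 1 ≤ (T : ℝ) / δ := (one_le_div hδ).2 (hδ1.le.trans hT')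
  have hTε : (T : ℝ) / ε ^ 2 ≤ T / δ * (T / ε ^ 2) := le_mul_of_one_le_left (by positivity) hTδ
  rw [← Real.log_mul (by positivity) (by positivity)]
  exact Real.log_le_log (by positivity) (by linarith)

theorem log_one_add_cube_div_sq_le (hT : 1 ≤ T) (hδ : 0 < δ) (hδ1 : δ < 1) :
    Real.log (1 + (T : ℝ) ^ 3 / ε ^ 2) ≤ 3 * Real.log (T / δ + T / ε ^ 2) := by
  have hT' : (1 : ℝ) ≤ T := by exact_mod_cast hT
  have hTδ : (T : ℝ) ≤ T / δ := le_div_self (by positivity) hδ hδ1.le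
  have hε : 1 ≤ 1 + 1 / ε ^ 2 := le_add_of_nonneg_right (by positivity)
  rw [← Nat.cast_ofNat (R := ℝ), ← Real.log_pow]
  refine Real.log_le_log (by positivity) ?_
  calc 1 + (T : ℝ) ^ 3 / ε ^ 2 ≤ (T : ℝ) ^ 3 + (T : ℝ) ^ 3 / ε ^ 2 := by
        gcongr
        exact one_le_pow₀ hT'
    _ = (T : ℝ) ^ 3 * (1 + 1 / ε ^ 2) := by ring
    _ ≤ (T : ℝ) ^ 3 * (1 + 1 / ε ^ 2) ^ 3 := by
        gcongr
        exact le_self_pow₀ hε (by norm_num)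
    _ = (T + T / ε ^ 2) ^ 3 := by ring
    _ ≤ (T / δ + T / ε ^ 2) ^ 3 := by gcongr

/-- The part of `polyJ` that depends neither on `T` nor on `ε`: up to universal constants,
`polyJ - 1` lies between this coefficient times `T / ε ^ 2` and times `T ^ 3 / ε ^ 2`. -/
def polyJCoeff (d : ℕ) (B C C₀ G : ℝ) : ℝ := (B + 1) * (G ^ 2 + C₀ ^ 2 * d) + C

theorem polyJCoeff_nonneg (hB : 0 ≤ B) (hC : 0 ≤ C) : 0 ≤ polyJCoeff d B C C₀ G := by
  unfold polyJCoeff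
  positivity

theorem one_le_polyJ (hB : 0 ≤ B) (hC : 0 ≤ C) : 1 ≤ polyJ d T B C C₀ ε G :=
  le_add_of_nonneg_right (by positivity)

theorem log_polyJ_nonneg (hB : 0 ≤ B) (hC : 0 ≤ C) : 0 ≤ Real.log (polyJ d T B C C₀ ε G) :=
  Real.log_nonneg (one_le_polyJ hB hC)

theorem polyJ_le (hT : 1 ≤ T) (hB : 0 ≤ B) (hC : 0 ≤ C) :
    polyJ d T B C C₀ ε G ≤ 1 + 4 * polyJCoeff d B C C₀ G * ((T : ℝ) ^ 3 / ε ^ 2) := by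
  have hT' : (1 : ℝ) ≤ T := by exact_mod_cast hT
  have hT2 : (1 : ℝ) ≤ (T : ℝ) ^ 2 := one_le_pow₀ hT'
  have hsq : (G + C₀ * √d * T) ^ 2 ≤ 2 * (G ^ 2 + C₀ ^ 2 * d) * T ^ 2 :=
    calc (G + C₀ * √d * T) ^ 2 ≤ 2 * (G ^ 2 + (C₀ * √d * T) ^ 2) := add_sq_le
      _ = 2 * (G ^ 2 + C₀ ^ 2 * d * T ^ 2) := by
          rw [mul_pow, mul_pow, Real.sq_sqrt (Nat.cast_nonneg d)]
      _ ≤ 2 * (G ^ 2 * T ^ 2 + C₀ ^ 2 * d * T ^ 2) := by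
          gcongr
          exact le_mul_of_one_le_right (sq_nonneg G) hT2
      _ = 2 * (G ^ 2 + C₀ ^ 2 * d) * T ^ 2 := by ring
  calc polyJ d T B C C₀ ε G
      ≤ 1 + 1 / ε ^ 2 * (2 * (B + 1) * (2 * (G ^ 2 + C₀ ^ 2 * d) * T ^ 2) * T
          + 4 * (C * T ^ 2) * T) := by
        unfold polyJ
        gcongr
        · norm_num
        · exact le_mul_of_one_le_right hC hT2
    _ = 1 + 4 * polyJCoeff d B C C₀ G * ((T : ℝ) ^ 3 / ε ^ 2) := by
        unfold polyJCoeff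
        ring

theorem le_polyJ (hT : 1 ≤ T) (hB : 0 ≤ B) (hC : 0 ≤ C) (hC₀ : 0 ≤ C₀) (hG : 0 ≤ G) :
    1 + 2 * (C₀ ^ 2 * d) * (T / ε ^ 2) ≤ polyJ d T B C C₀ ε G := by
  have hT' : (1 : ℝ) ≤ T := by exact_mod_cast hT
  have hsq : C₀ ^ 2 * d ≤ (G + C₀ * √d * T) ^ 2 :=
    calc C₀ ^ 2 * d = (C₀ * √d) ^ 2 := by rw [mul_pow, Real.sq_sqrt (Nat.cast_nonneg d)]
      _ ≤ (G + C₀ * √d * T) ^ 2 := by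
        gcongr
        exact (le_mul_of_one_le_right (by positivity) hT').trans (le_add_of_nonneg_left hG)
  calc 1 + 2 * (C₀ ^ 2 * d) * (T / ε ^ 2)
      = 1 + 1 / ε ^ 2 * (2 * (0 + 1) * (C₀ ^ 2 * d) * T + 2 * 0 * T) := by ring
    _ ≤ polyJ d T B C C₀ ε G := by
        unfold polyJ
        gcongr

theorem log_polyJ_le_log_one_add (hT : 1 ≤ T) (hB : 0 ≤ B) (hC : 0 ≤ C) :
    Real.log (polyJ d T B C C₀ ε G) ≤
      Real.log (1 + 4 * polyJCoeff d B C C₀ G * ((T : ℝ) ^ 3 / ε ^ 2)) :=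
  Real.log_le_log (zero_lt_one.trans_le (one_le_polyJ hB hC)) (polyJ_le hT hB hC)

theorem log_polyJ_le_add (hT : 1 ≤ T) (hB : 0 ≤ B) (hC : 0 ≤ C) (hδ : 0 < δ) (hδ1 : δ < 1) :
    Real.log (polyJ d T B C C₀ ε G) ≤ 3 * Real.log (T / δ + T / ε ^ 2)
      + 4 * Real.log (1 + polyJCoeff d B C C₀ G) := by
  have hm : 0 ≤ polyJCoeff d B C C₀ G := polyJCoeff_nonneg hB hC
  linarith [log_polyJ_le_log_one_add (d := d) (C₀ := C₀) (ε := ε) (G := G) hT hB hC,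
    log_one_add_mul_le_add_log (a := 4 * polyJCoeff d B C C₀ G) (y := (T : ℝ) ^ 3 / ε ^ 2)
      (by positivity) (by positivity),
    log_one_add_mul_le_mul_log (K := 4) (by norm_num) hm,
    log_one_add_cube_div_sq_le (ε := ε) hT hδ hδ1]

theorem log_polyJ_le_mul (hT : 1 ≤ T) (hB : 0 ≤ B) (hC : 0 ≤ C) (hδ : 0 < δ) (hδ1 : δ < 1) :
    Real.log (polyJ d T B C C₀ ε G) ≤
      (1 + 4 * polyJCoeff d B C C₀ G) * (3 * Real.log (T / δ + T / ε ^ 2)) := by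
  have hm : 0 ≤ polyJCoeff d B C C₀ G := polyJCoeff_nonneg hB hC
  calc Real.log (polyJ d T B C C₀ ε G)
      ≤ Real.log (1 + 4 * polyJCoeff d B C C₀ G * ((T : ℝ) ^ 3 / ε ^ 2)) :=
        log_polyJ_le_log_one_add hT hB hC
    _ ≤ Real.log (1 + (1 + 4 * polyJCoeff d B C C₀ G) * ((T : ℝ) ^ 3 / ε ^ 2)) := by
        gcongr
        linarith
    _ ≤ (1 + 4 * polyJCoeff d B C C₀ G) * Real.log (1 + (T : ℝ) ^ 3 / ε ^ 2) :=
        log_one_add_mul_le_mul_log (by linarith) (by positivity)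
    _ ≤ (1 + 4 * polyJCoeff d B C C₀ G) * (3 * Real.log (T / δ + T / ε ^ 2)) := by
        gcongr
        exact log_one_add_cube_div_sq_le hT hδ hδ1

theorem log_one_add_div_sq_le (hd : 1 ≤ d) (hT : 1 ≤ T) (hB : 0 ≤ B) (hC : 0 ≤ C)
    (hC₀ : 0 < C₀) (hG : 0 ≤ G) :
    Real.log (1 + T / ε ^ 2) ≤
      (1 + 1 / (2 * (C₀ ^ 2 * d))) * Real.log (polyJ d T B C C₀ ε G) := by
  have hD : 0 < 2 * (C₀ ^ 2 * (d : ℝ)) := by positivity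
  have hcancel : 1 ≤ (1 + 1 / (2 * (C₀ ^ 2 * d))) * (2 * (C₀ ^ 2 * (d : ℝ))) := by
    rw [add_mul, one_div_mul_cancel hD.ne']
    linarith
  have hy : 0 ≤ (T : ℝ) / ε ^ 2 := by positivity
  calc Real.log (1 + T / ε ^ 2)
      ≤ Real.log (1 + (1 + 1 / (2 * (C₀ ^ 2 * d))) * (2 * (C₀ ^ 2 * d) * (T / ε ^ 2))) := by
        gcongr
        rw [← mul_assoc]
        exact le_mul_of_one_le_left hy hcancel
    _ ≤ (1 + 1 / (2 * (C₀ ^ 2 * d))) * Real.log (1 + 2 * (C₀ ^ 2 * d) * (T / ε ^ 2)) :=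
        log_one_add_mul_le_mul_log (le_add_of_nonneg_right (by positivity)) (by positivity)
    _ ≤ (1 + 1 / (2 * (C₀ ^ 2 * d))) * Real.log (polyJ d T B C C₀ ε G) := by
        gcongr
        exact le_polyJ hT hB hC hC₀.le hG

theorem LambdaY_eq : LambdaY d T B C C₀ ε δ Δ₁ G = Δ₁ + 3 * C₀ * Real.log (T / δ)
    + (C₀ * d + 3 / 2 * (C₀ ^ 2 * d)) * Real.log (polyJ d T B C C₀ ε G) := by
  unfold LambdaY
  ring

theorem LambdaY_ge (hB : 0 ≤ B) (hC : 0 ≤ C) (hC₀ : 0 ≤ C₀) :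
    Δ₁ + 3 * C₀ * Real.log (T / δ) + C₀ ^ 2 * d * Real.log (polyJ d T B C C₀ ε G) ≤
      LambdaY d T B C C₀ ε δ Δ₁ G := by
  have hJ : 0 ≤ Real.log (polyJ d T B C C₀ ε G) := log_polyJ_nonneg hB hC
  rw [LambdaY_eq]
  gcongr
  have : 0 ≤ C₀ * d := by positivity
  have : 0 ≤ C₀ ^ 2 * d := by positivity
  linarith

theorem LambdaY_ge_add_log_div (hB : 0 ≤ B) (hC : 0 ≤ C) (hC₀ : 0 ≤ C₀) :
    Δ₁ + 3 * C₀ * Real.log (T / δ) ≤ LambdaY d T B C C₀ ε δ Δ₁ G :=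
  (le_add_of_nonneg_right (mul_nonneg (by positivity) (log_polyJ_nonneg hB hC))).trans
    (LambdaY_ge hB hC hC₀)

theorem LambdaY_pos (hT : 1 ≤ T) (hB : 0 ≤ B) (hC : 0 ≤ C) (hC₀ : 0 < C₀)
    (hδ : 0 < δ) (hδ1 : δ < 1) (hΔ : 0 ≤ Δ₁) : 0 < LambdaY d T B C C₀ ε δ Δ₁ G := by
  have := log_div_pos hT hδ hδ1
  exact (by positivity : 0 < Δ₁ + 3 * C₀ * Real.log (T / δ)).trans_le
    (LambdaY_ge_add_log_div hB hC hC₀.le)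

theorem LambdaY_le_eight_mul (hd : 1 ≤ d) (hT : 1 ≤ T) (hB : 0 ≤ B) (hC : 0 ≤ C) (hC₀ : 0 ≤ C₀)
    (hδ : 0 < δ) (hδ1 : δ < 1) (hΔ : 0 ≤ Δ₁) :
    LambdaY d T B C C₀ ε δ Δ₁ G ≤
      8 * (Δ₁ + (C₀ ^ 2 * d + C₀ * d) * (Real.log (T / δ + T / ε ^ 2)
        + Real.log (1 + (B + 1) * (G ^ 2 + C₀ ^ 2 * d) + C))) := by
  have hd' : (1 : ℝ) ≤ d := by exact_mod_cast hd
  rw [LambdaY_eq, add_assoc 1 ((B + 1) * _) C, ← polyJCoeff]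
  have hlog := log_div_le_log_div_add_div_sq (ε := ε) hT hδ
  have hlog0 := (log_div_pos hT hδ hδ1).le
  have hJ := log_polyJ_le_add (d := d) (C₀ := C₀) (ε := ε) (G := G) hT hB hC hδ hδ1
  have hJ0 : 0 ≤ Real.log (polyJ d T B C C₀ ε G) := log_polyJ_nonneg hB hC
  have hm : 0 ≤ Real.log (1 + polyJCoeff d B C C₀ G) :=
    Real.log_nonneg (le_add_of_nonneg_right (polyJCoeff_nonneg hB hC))
  set ℓ := Real.log (T / δ + T / ε ^ 2)
  set ℓ' := Real.log (1 + polyJCoeff d B C C₀ G)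
  set D := C₀ ^ 2 * (d : ℝ) + C₀ * d
  have hℓ : 0 ≤ ℓ := hlog0.trans hlog
  have hC₀D : C₀ ≤ D :=
    (le_mul_of_one_le_right hC₀ hd').trans (le_add_of_nonneg_left (by positivity))
  have hcoeff : C₀ * d + 3 / 2 * (C₀ ^ 2 * d) ≤ 3 / 2 * D := by
    have : 0 ≤ C₀ * d := by positivity
    linarith
  calc Δ₁ + 3 * C₀ * Real.log (T / δ)
        + (C₀ * d + 3 / 2 * (C₀ ^ 2 * d)) * Real.log (polyJ d T B C C₀ ε G)
      ≤ Δ₁ + 3 * D * ℓ + 3 / 2 * D * (3 * ℓ + 4 * ℓ') := by gcongr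
    _ ≤ 8 * (Δ₁ + D * (ℓ + ℓ')) := by
        have : 0 ≤ D * ℓ := by positivity
        have : 0 ≤ D * ℓ' := by positivity
        linarith

theorem add_log_le_mul_LambdaY (hd : 1 ≤ d) (hT : 1 ≤ T) (hB : 0 ≤ B) (hC : 0 ≤ C)
    (hC₀ : 0 < C₀) (hδ : 0 < δ) (hδ1 : δ < 1) (hΔ : 0 ≤ Δ₁) (hG : 0 ≤ G) :
    Δ₁ + C₀ ^ 2 * d * Real.log (T / δ + T / ε ^ 2) ≤
      (1 + C₀ * d + (1 + 1 / (2 * (C₀ ^ 2 * d)))) * LambdaY d T B C C₀ ε δ Δ₁ G := by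
  have hlog := log_div_pos hT hδ hδ1
  have hJ : 0 ≤ Real.log (polyJ d T B C C₀ ε G) := log_polyJ_nonneg hB hC
  have hY := LambdaY_ge (d := d) (T := T) (ε := ε) (δ := δ) (Δ₁ := Δ₁) (G := G) hB hC hC₀.le
  have hsplit := (log_div_add_div_sq_le_add (ε := ε) hT hδ hδ1).trans
    (add_le_add_right (log_one_add_div_sq_le (ε := ε) hd hT hB hC hC₀ hG) _)
  set Y := LambdaY d T B C C₀ ε δ Δ₁ G
  set J := Real.log (polyJ d T B C C₀ ε G)
  set p := 1 + 1 / (2 * (C₀ ^ 2 * (d : ℝ)))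
  have hJ' : 0 ≤ C₀ ^ 2 * d * J := by positivity
  have hlog' : 0 ≤ C₀ * Real.log (T / δ) := by positivity
  calc Δ₁ + C₀ ^ 2 * d * Real.log (T / δ + T / ε ^ 2)
      ≤ Δ₁ + C₀ ^ 2 * d * (Real.log (T / δ) + p * J) := by gcongr
    _ = Δ₁ + C₀ * d * (C₀ * Real.log (T / δ)) + p * (C₀ ^ 2 * d * J) := by ring
    _ ≤ Y + C₀ * d * Y + p * Y := by gcongr <;> linarith
    _ = (1 + C₀ * d + p) * Y := by ring

theorem LambdaY_le_mul (hd : 1 ≤ d) (hT : 1 ≤ T) (hB : 0 ≤ B) (hC : 0 ≤ C)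
    (hC₀ : 0 < C₀) (hδ : 0 < δ) (hδ1 : δ < 1) (hΔ : 0 ≤ Δ₁) :
    LambdaY d T B C C₀ ε δ Δ₁ G ≤
      (1 + (3 * C₀ + (C₀ * d + 3 / 2 * (C₀ ^ 2 * d)) * ((1 + 4 * polyJCoeff d B C C₀ G) * 3))
        / (C₀ ^ 2 * d)) * (Δ₁ + C₀ ^ 2 * d * Real.log (T / δ + T / ε ^ 2)) := by
  have hm : 0 ≤ polyJCoeff d B C C₀ G := polyJCoeff_nonneg hB hC
  have hlog := log_div_le_log_div_add_div_sq (ε := ε) hT hδ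
  have hJ := log_polyJ_le_mul (d := d) (C₀ := C₀) (ε := ε) (G := G) hT hB hC hδ hδ1
  set ℓ := Real.log (T / δ + T / ε ^ 2)
  set D := C₀ ^ 2 * (d : ℝ)
  set M := 3 * C₀ + (C₀ * d + 3 / 2 * D) * ((1 + 4 * polyJCoeff d B C C₀ G) * 3) with hM
  have hD : 0 < D := by positivity
  have hℓ : 0 ≤ ℓ := (log_div_pos hT hδ hδ1).le.trans hlog
  calc LambdaY d T B C C₀ ε δ Δ₁ G
      ≤ Δ₁ + 3 * C₀ * ℓ
          + (C₀ * d + 3 / 2 * D) * ((1 + 4 * polyJCoeff d B C C₀ G) * (3 * ℓ)) := by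
        rw [LambdaY_eq]
        gcongr
    _ = Δ₁ + M / D * (D * ℓ) := by
        rw [hM]
        field_simp
        ring
    _ ≤ (1 + M / D) * (Δ₁ + D * ℓ) := by
        have : 0 ≤ M / D * Δ₁ := by positivity
        have : 0 ≤ D * ℓ := by positivity
        linarith

theorem exists_LambdaY_bounds (hd : 1 ≤ d) (hB : 0 ≤ B) (hC : 0 ≤ C) (hC₀ : 0 < C₀)
    (hG : 0 ≤ G) :
    ∃ k K : ℝ, 0 < k ∧ 0 < K ∧
      ∀ (T : ℕ) (ε δ Δ₁ : ℝ), 1 ≤ T → 0 < δ → δ < 1 → 0 ≤ Δ₁ →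
        k * (Δ₁ + C₀ ^ 2 * d * Real.log (T / δ + T / ε ^ 2)) ≤ LambdaY d T B C C₀ ε δ Δ₁ G ∧
        LambdaY d T B C C₀ ε δ Δ₁ G ≤
          K * (Δ₁ + C₀ ^ 2 * d * Real.log (T / δ + T / ε ^ 2)) := by
  have hm : 0 ≤ polyJCoeff d B C C₀ G := polyJCoeff_nonneg hB hC
  have hk : 0 < 1 + C₀ * d + (1 + 1 / (2 * (C₀ ^ 2 * (d : ℝ)))) := by positivity
  refine ⟨_, _, inv_pos.2 hk, ?_, fun T ε δ Δ₁ hT hδ hδ1 hΔ =>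
    ⟨(inv_mul_le_iff₀ hk).2 (add_log_le_mul_LambdaY hd hT hB hC hC₀ hδ hδ1 hΔ hG),
      LambdaY_le_mul hd hT hB hC hC₀ hδ hδ1 hΔ⟩⟩
  positivity

theorem LambdaY_add_sq_le_LambdaX (hL₀ : 0 ≤ L₀) (hB : 0 ≤ B) (hC : 0 ≤ C)
    (hY : 0 ≤ LambdaY d T B C C₀ ε δ Δ₁ G) :
    LambdaY d T B C C₀ ε δ Δ₁ G + 8 * L₁ * LambdaY d T B C C₀ ε δ Δ₁ G ^ 2 ≤
      LambdaX d T L₀ L₁ B C C₀ ε δ Δ₁ G := by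
  have : 0 ≤ C₀ ^ 2 * d * Real.log (polyJ d T B C C₀ ε G) :=
    mul_nonneg (by positivity) (log_polyJ_nonneg hB hC)
  have : 0 ≤ 2 * L₀ * LambdaY d T B C C₀ ε δ Δ₁ G := by positivity
  unfold LambdaX
  linarith

theorem LambdaX_le (hT : 1 ≤ T) (hB : 0 ≤ B) (hC : 0 ≤ C) (hC₀ : 0 ≤ C₀) (hδ : 0 < δ)
    (hδ1 : δ < 1) (hΔ : 0 ≤ Δ₁) :
    LambdaX d T L₀ L₁ B C C₀ ε δ Δ₁ G ≤ (2 * L₀ + 2) * LambdaY d T B C C₀ ε δ Δ₁ G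
      + 8 * L₁ * LambdaY d T B C C₀ ε δ Δ₁ G ^ 2 := by
  have := LambdaY_ge (d := d) (T := T) (ε := ε) (δ := δ) (Δ₁ := Δ₁) (G := G) hB hC hC₀
  have : 0 ≤ 3 * C₀ * Real.log (T / δ) := mul_nonneg (by positivity) (log_div_pos hT hδ hδ1).le
  unfold LambdaX
  linarith

theorem LambdaY_le_mul_sq (hT : 2 ≤ T) (hB : 0 ≤ B) (hC : 0 ≤ C) (hC₀ : 0 < C₀) (hδ : 0 < δ)
    (hδ1 : δ < 1) (hΔ : 0 ≤ Δ₁) :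
    LambdaY d T B C C₀ ε δ Δ₁ G ≤
      1 / (3 * C₀ * Real.log 2) * LambdaY d T B C C₀ ε δ Δ₁ G ^ 2 := by
  have hT' : (2 : ℝ) ≤ T := by exact_mod_cast hT
  have hY : 0 < LambdaY d T B C C₀ ε δ Δ₁ G :=
    LambdaY_pos (one_le_two.trans hT) hB hC hC₀ hδ hδ1 hΔ
  have hlower : 3 * C₀ * Real.log 2 ≤ LambdaY d T B C C₀ ε δ Δ₁ G :=
    calc 3 * C₀ * Real.log 2 ≤ 3 * C₀ * Real.log (T / δ) := by
          gcongr
          exact hT'.trans (le_div_self (by positivity) hδ hδ1.le)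
      _ ≤ Δ₁ + 3 * C₀ * Real.log (T / δ) := le_add_of_nonneg_left hΔ
      _ ≤ LambdaY d T B C C₀ ε δ Δ₁ G := LambdaY_ge_add_log_div hB hC hC₀.le
  rw [one_div, le_inv_mul_iff₀ (by positivity), sq]
  gcongr

theorem exists_LambdaX_bounds (hL₀ : 0 ≤ L₀) (hL₁ : 0 < L₁) (hC₀ : 0 < C₀) :
    ∃ k K : ℝ, 0 < k ∧ 0 < K ∧
      ∀ (d T : ℕ) (B C ε δ Δ₁ G : ℝ), 1 ≤ T → 0 ≤ B → 0 ≤ C → 0 < δ → δ < 1 → 0 ≤ Δ₁ →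
        k * LambdaY d T B C C₀ ε δ Δ₁ G ^ 2 ≤ LambdaX d T L₀ L₁ B C C₀ ε δ Δ₁ G ∧
        LambdaX d T L₀ L₁ B C C₀ ε δ Δ₁ G ≤
          K * (LambdaY d T B C C₀ ε δ Δ₁ G + LambdaY d T B C C₀ ε δ Δ₁ G ^ 2) ∧
        (2 ≤ T → LambdaX d T L₀ L₁ B C C₀ ε δ Δ₁ G ≤ K * LambdaY d T B C C₀ ε δ Δ₁ G ^ 2) := by
  set q := 1 / (3 * C₀ * Real.log 2)
  refine ⟨8 * L₁, (2 * L₀ + 2) * (1 + q) + 8 * L₁, by positivity, by positivity, ?_⟩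
  intro d T B C ε δ Δ₁ G hT hB hC hδ hδ1 hΔ
  have hY := LambdaY_pos (d := d) (ε := ε) (G := G) hT hB hC hC₀ hδ hδ1 hΔ
  have hlower := LambdaY_add_sq_le_LambdaX (L₁ := L₁) hL₀ hB hC hY.le
  have hupper := LambdaX_le (d := d) (L₀ := L₀) (L₁ := L₁) (ε := ε) (G := G) hT hB hC hC₀.le
    hδ hδ1 hΔ
  have hsq := fun hT2 : 2 ≤ T =>
    LambdaY_le_mul_sq (d := d) (ε := ε) (G := G) hT2 hB hC hC₀ hδ hδ1 hΔ
  set Y := LambdaY d T B C C₀ ε δ Δ₁ G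
  refine ⟨by linarith, hupper.trans ?_, fun hT2 => hupper.trans ?_⟩
  · have : 0 ≤ (2 * L₀ + 2) * q * Y := by positivity
    have : 0 ≤ (2 * L₀ + 2) * (1 + q) * Y ^ 2 := by positivity
    have : 0 ≤ 8 * L₁ * Y := by positivity
    linarith
  · have : (2 * L₀ + 2) * Y ≤ (2 * L₀ + 2) * (q * Y ^ 2) := by gcongr; exact hsq hT2
    have : 0 ≤ (2 * L₀ + 2) * Y ^ 2 := by positivity
    linarith

end Orders

section Decoupling

section WeightedInner

variable {ι : Type*} [Fintype ι]

/-- The scalar product with weight `1 / a i` in the coordinate `i`. -/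
def weightedInner (a : ι → ℝ) (p q : EuclideanSpace ℝ ι) : ℝ := ∑ i, p i * q i / a i

variable {a : ι → ℝ} {p q : EuclideanSpace ℝ ι}

theorem weightedInner_self_nonneg (ha : ∀ i, 0 ≤ a i) : 0 ≤ weightedInner a p p :=
  Finset.sum_nonneg fun i _ => div_nonneg (mul_self_nonneg _) (ha i)

theorem sq_weightedInner_le (ha : ∀ i, 0 ≤ a i) :
    weightedInner a p q ^ 2 ≤ weightedInner a p p * weightedInner a q q :=
  Finset.sum_sq_le_sum_mul_sum_of_sq_le_mul _
    (fun i _ => div_nonneg (mul_self_nonneg _) (ha i))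
    (fun i _ => div_nonneg (mul_self_nonneg _) (ha i))
    fun i _ => le_of_eq (by ring)

theorem weightedInner_self_le_norm (ha : ∀ i, ‖q‖ ≤ a i) : weightedInner a q q ≤ ‖q‖ := by
  rcases eq_or_ne q 0 with rfl | hq
  · simp [weightedInner]
  have hq' : 0 < ‖q‖ := norm_pos_iff.2 hq
  calc weightedInner a q q ≤ ∑ i, q i * q i / ‖q‖ :=
        Finset.sum_le_sum fun i _ => div_le_div_of_nonneg_left (mul_self_nonneg _) hq' (ha i)
    _ = ‖q‖ := by
        simp_rw [← sq]
        rw [← Finset.sum_div, ← EuclideanSpace.real_norm_sq_eq, sq, mul_self_div_self]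

theorem sq_norm_le_mul_weightedInner_self {A : ℝ} (ha : ∀ i, 0 < a i) (haA : ∀ i, a i ≤ A) :
    ‖p‖ ^ 2 ≤ A * weightedInner a p p := by
  rw [EuclideanSpace.real_norm_sq_eq, weightedInner, Finset.mul_sum]
  refine Finset.sum_le_sum fun i _ => ?_
  rw [← mul_div_assoc, le_div_iff₀ (ha i), ← sq, mul_comm]
  gcongr
  exact haA i

theorem integral_weightedInner {Z : Type*} [MeasurableSpace Z] {P : Measure Z}
    {q : Z → EuclideanSpace ℝ ι} (hq : Integrable q P) :
    ∫ z, weightedInner a p (q z) ∂P = weightedInner a p (∫ z, q z ∂P) := by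
  have hcoord (i : ι) : Integrable (fun z => q z i) P := hq.eval_piLp i
  simp only [weightedInner]
  rw [integral_finsetSum _ fun i _ => ((hcoord i).const_mul _).div_const _]
  simp only [integral_div, integral_const_mul, eval_integral_piLp hcoord]

end WeightedInner

section Direction

variable {ι : Type*} {ε r : ℝ} {p v γ : EuclideanSpace ℝ ι}

/-- The predictable substitute for the AdaGrad denominator `√(v + γ²) + ε`: the squared stochastic
gradient `γ²` is replaced by the square of an a priori bound `r` on `‖γ‖`. -/
def proxyDenom (ε r : ℝ) (v : EuclideanSpace ℝ ι) (i : ι) : ℝ := √(v i + r ^ 2) + ε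

theorem proxyDenom_pos (hε : 0 < ε) (i : ι) : 0 < proxyDenom ε r v i := by
  unfold proxyDenom
  positivity

theorem le_proxyDenom (hε : 0 ≤ ε) (hv : ∀ i, 0 ≤ v i) (i : ι) : r ≤ proxyDenom ε r v i :=
  (Real.le_sqrt_of_sq_le (le_add_of_nonneg_left (hv i))).trans (le_add_of_nonneg_right hε)

/-- The AdaGrad update direction for the accumulated squares `v` and the stochastic gradient `γ`:
the step is `-η • direction ε v γ`. -/
def direction (ε : ℝ) (v γ : EuclideanSpace ℝ ι) : EuclideanSpace ℝ ι :=
  WithLp.toLp 2 fun i => γ i / (√(v i + γ i ^ 2) + ε)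

theorem sq_sqrt_add_sub_sqrt_add_le {u s : ℝ} (hu : 0 ≤ u) (hs : |s| ≤ r) (hε : 0 ≤ ε) :
    ((√(u + r ^ 2) + ε) - (√(u + s ^ 2) + ε)) ^ 2 ≤ r * (√(u + r ^ 2) + ε) := by
  have hr : 0 ≤ r := (abs_nonneg s).trans hs
  have hsr : √(u + s ^ 2) ≤ √(u + r ^ 2) :=
    Real.sqrt_le_sqrt (add_le_add_right (sq_le_sq' (neg_le_of_abs_le hs) (le_of_abs_le hs)) u)
  have hrs : √(u + r ^ 2) ≤ √(u + s ^ 2) + r := by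
    refine Real.sqrt_le_iff.2 ⟨by positivity, ?_⟩
    have : 0 ≤ √(u + s ^ 2) * r := by positivity
    linarith [Real.sq_sqrt (add_nonneg hu (sq_nonneg s)), sq_nonneg s]
  have hs0 : 0 ≤ √(u + s ^ 2) := Real.sqrt_nonneg _
  rw [add_sub_add_right_eq_sub, sq]
  exact mul_le_mul (by linarith) (by linarith) (by linarith) hr

theorem le_mul_div_of_sq_sub_le {a b p s : ℝ} (ha : 0 < a) (hb : b ≠ 0)
    (hab : (a - b) ^ 2 ≤ r * a) :
    3 / 4 * (p * p / a) + p * (s - p) / a - r * (s / b) ^ 2 ≤ p * (s / b) := by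
  -- Exchanging the denominators costs `-p w (a - b) / a`, where `w = s / b` is the actual step.
  have hexchange : p * (s / b) = p * s / a + p * (s / b) * (a - b) / a := by
    field_simp
    ring
  have hamgm : -(p * (s / b) * (a - b)) ≤ p * p / 4 + (s / b) ^ 2 * (r * a) := by
    have := mul_le_mul_of_nonneg_left hab (sq_nonneg (s / b))
    linarith [sq_nonneg (p / 2 + s / b * (a - b))]
  have hcost : -(p * (s / b) * (a - b) / a) ≤ 1 / 4 * (p * p / a) + r * (s / b) ^ 2 := by
    rw [← neg_div, div_le_iff₀ ha]
    refine hamgm.trans_eq ?_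
    field_simp
  rw [hexchange, mul_sub, sub_div]
  linarith

variable [Fintype ι]

theorem sq_norm_direction : ‖direction ε v γ‖ ^ 2 = ∑ i, (γ i / (√(v i + γ i ^ 2) + ε)) ^ 2 :=
  EuclideanSpace.real_norm_sq_eq _

theorem norm_direction_le (hε : 0 ≤ ε) (hv : ∀ i, 0 ≤ v i) :
    ‖direction ε v γ‖ ≤ √(Fintype.card ι) := by
  refine Real.le_sqrt_of_sq_le ?_
  rw [sq_norm_direction, Fintype.card_eq_sum_ones, Nat.cast_sum]
  refine Finset.sum_le_sum fun i _ => ?_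
  have hγ : |γ i| ≤ √(v i + γ i ^ 2) + ε := le_proxyDenom (r := |γ i|) hε hv i |>.trans_eq (by
    rw [proxyDenom, sq_abs])
  rw [Nat.cast_one, sq_le_one_iff_abs_le_one, abs_div]
  exact div_le_one_of_le₀ (hγ.trans (le_abs_self _)) (abs_nonneg _)

theorem le_inner_direction (hε : 0 < ε) (hv : ∀ i, 0 ≤ v i) (hγ : ‖γ‖ ≤ r) :
    3 / 4 * weightedInner (proxyDenom ε r v) p p + weightedInner (proxyDenom ε r v) p (γ - p)
      - r * ‖direction ε v γ‖ ^ 2 ≤ inner ℝ p (direction ε v γ) := by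
  rw [sq_norm_direction, weightedInner, weightedInner, Finset.mul_sum, Finset.mul_sum,
    ← Finset.sum_add_distrib, ← Finset.sum_sub_distrib, PiLp.inner_apply]
  refine Finset.sum_le_sum fun i _ => ?_
  have hb : √(v i + γ i ^ 2) + ε ≠ 0 := by positivity
  have hγi : |γ i| ≤ r := (PiLp.norm_apply_le γ i).trans hγ
  simp only [RCLike.inner_apply, conj_trivial]
  rw [mul_comm (direction ε v γ i)]
  exact le_mul_div_of_sq_sub_le (proxyDenom_pos hε i) hb
    (sq_sqrt_add_sub_sqrt_add_le (hv i) hγi hε.le)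

end Direction

section Accumulation

theorem sq_div_le_log_sub_log {u s ε : ℝ} (hu : 0 ≤ u) (hε : 0 < ε) :
    (s / (√(u + s ^ 2) + ε)) ^ 2 ≤ Real.log (u + s ^ 2 + ε ^ 2) - Real.log (u + ε ^ 2) := by
  have hus : 0 ≤ u + s ^ 2 := by positivity
  have hnew : u + s ^ 2 + ε ^ 2 ≠ 0 := by positivity
  have hold : u + ε ^ 2 ≠ 0 := by positivity
  have hdenom : u + s ^ 2 + ε ^ 2 ≤ (√(u + s ^ 2) + ε) ^ 2 := by
    have : 0 ≤ √(u + s ^ 2) * ε := by positivity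
    linarith [Real.sq_sqrt hus]
  rw [← Real.log_div hnew hold]
  calc (s / (√(u + s ^ 2) + ε)) ^ 2 ≤ s ^ 2 / (u + s ^ 2 + ε ^ 2) := by
        rw [div_pow]
        gcongr
    _ = 1 - ((u + s ^ 2 + ε ^ 2) / (u + ε ^ 2))⁻¹ := by
        field_simp
        ring
    _ ≤ Real.log ((u + s ^ 2 + ε ^ 2) / (u + ε ^ 2)) :=
        Real.one_sub_inv_le_log_of_pos (by positivity)

variable {ι : Type*} {ε : ℝ} {v γ : ℕ → EuclideanSpace ℝ ι}

theorem accumulated_nonneg (hv0 : v 0 = 0) (hv : ∀ n i, v (n + 1) i = v n i + γ n i ^ 2)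
    (n : ℕ) (i : ι) : 0 ≤ v n i := by
  induction n with
  | zero => simp [hv0]
  | succ n ih =>
    rw [hv]
    positivity

variable [Fintype ι]

theorem accumulated_le (hv0 : v 0 = 0) (hv : ∀ n i, v (n + 1) i = v n i + γ n i ^ 2)
    (n : ℕ) (i : ι) : v n i ≤ ∑ k ∈ Finset.range n, ‖γ k‖ ^ 2 := by
  induction n with
  | zero => simp [hv0]
  | succ n ih =>
    rw [hv, Finset.sum_range_succ]
    exact add_le_add ih (sq_le_sq.2 ((PiLp.norm_apply_le (γ n) i).trans (le_abs_self _)))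

theorem sum_sq_norm_direction_le (hε : 0 < ε) (hv0 : v 0 = 0)
    (hv : ∀ n i, v (n + 1) i = v n i + γ n i ^ 2) {t : ℕ} {J : ℝ}
    (hJ : ∀ i, 1 + v t i / ε ^ 2 ≤ J) :
    ∑ n ∈ Finset.range t, ‖direction ε (v n) (γ n)‖ ^ 2 ≤ Fintype.card ι * Real.log J := by
  simp only [sq_norm_direction]
  rw [Finset.sum_comm, ← nsmul_eq_mul]
  refine Finset.sum_le_card_nsmul _ _ _ fun i _ => ?_
  have hvt : 0 ≤ v t i := accumulated_nonneg hv0 hv t i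
  calc ∑ n ∈ Finset.range t, (γ n i / (√(v n i + γ n i ^ 2) + ε)) ^ 2
      ≤ ∑ n ∈ Finset.range t, (Real.log (v (n + 1) i + ε ^ 2) - Real.log (v n i + ε ^ 2)) := by
        refine Finset.sum_le_sum fun n _ => ?_
        rw [hv]
        exact sq_div_le_log_sub_log (accumulated_nonneg hv0 hv n i) hε
    _ = Real.log (v t i + ε ^ 2) - Real.log (ε ^ 2) := by
        rw [Finset.sum_range_sub (fun n => Real.log (v n i + ε ^ 2)), hv0, PiLp.zero_apply,
          zero_add]
    _ = Real.log (1 + v t i / ε ^ 2) := by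
        rw [← Real.log_div (by positivity) (by positivity), add_div, div_self (by positivity),
          add_comm]
    _ ≤ Real.log J := Real.log_le_log (by positivity) (hJ i)

end Accumulation

section AffineNoise

/-- The bound `√(2 (B + 1) N² + 2 C)` on the norm of a stochastic gradient whose noise is affine
with constants `B` and `C`, where the gradient has norm `N`. -/
def noiseBound (B C N : ℝ) : ℝ := √(2 * (B + 1) * N ^ 2 + 2 * C)

theorem noiseBound_nonneg (B C N : ℝ) : 0 ≤ noiseBound B C N := Real.sqrt_nonneg _

theorem sq_noiseBound {B C : ℝ} (hB : 0 ≤ B) (hC : 0 ≤ C) (N : ℝ) :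
    noiseBound B C N ^ 2 = 2 * (B + 1) * N ^ 2 + 2 * C :=
  Real.sq_sqrt (by positivity)

theorem noiseBound_mono {B C N N' : ℝ} (hB : 0 ≤ B) (hN : 0 ≤ N) (h : N ≤ N') :
    noiseBound B C N ≤ noiseBound B C N' := by
  unfold noiseBound
  gcongr

section Norm

variable {E : Type*} [SeminormedAddCommGroup E] {B C : ℝ} {p γ : E}

theorem norm_sub_le_noiseBound (hB : 0 ≤ B) (hC : 0 ≤ C)
    (h : ‖γ - p‖ ^ 2 ≤ B * ‖p‖ ^ 2 + C) : ‖γ - p‖ ≤ noiseBound B C ‖p‖ := by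
  refine Real.le_sqrt_of_sq_le (h.trans ?_)
  have : 0 ≤ B * ‖p‖ ^ 2 := by positivity
  linarith [sq_nonneg ‖p‖]

theorem norm_le_noiseBound (h : ‖γ - p‖ ^ 2 ≤ B * ‖p‖ ^ 2 + C) :
    ‖γ‖ ≤ noiseBound B C ‖p‖ := by
  refine Real.le_sqrt_of_sq_le ?_
  calc ‖γ‖ ^ 2 ≤ (‖γ - p‖ + ‖p‖) ^ 2 := by
        gcongr
        simpa using norm_add_le (γ - p) p
    _ ≤ 2 * (‖γ - p‖ ^ 2 + ‖p‖ ^ 2) := add_sq_le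
    _ ≤ 2 * (B + 1) * ‖p‖ ^ 2 + 2 * C := by linarith

end Norm

variable {ι : Type*} [Fintype ι] {B C ε : ℝ} {p v γ : EuclideanSpace ℝ ι}

/-- The squared norm of the gradient `p`, with the predictable AdaGrad weights. -/
def weightedGradSq (B C ε : ℝ) (p v : EuclideanSpace ℝ ι) : ℝ :=
  weightedInner (proxyDenom ε (noiseBound B C ‖p‖) v) p p

/-- The scalar product of the gradient `p` with the noise `γ - p` of the stochastic gradient `γ`,
with the predictable AdaGrad weights. -/
def weightedNoise (B C ε : ℝ) (p v γ : EuclideanSpace ℝ ι) : ℝ :=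
  weightedInner (proxyDenom ε (noiseBound B C ‖p‖) v) p (γ - p)

theorem weightedGradSq_nonneg (hε : 0 < ε) : 0 ≤ weightedGradSq B C ε p v :=
  weightedInner_self_nonneg fun i => (proxyDenom_pos hε i).le

theorem sq_weightedNoise_le (hε : 0 < ε) (hB : 0 ≤ B) (hC : 0 ≤ C) (hv : ∀ i, 0 ≤ v i)
    (h : ‖γ - p‖ ^ 2 ≤ B * ‖p‖ ^ 2 + C) :
    weightedNoise B C ε p v γ ^ 2 ≤ noiseBound B C ‖p‖ * weightedGradSq B C ε p v := by
  have hnoise := norm_sub_le_noiseBound hB hC h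
  have hself : weightedInner (proxyDenom ε (noiseBound B C ‖p‖) v) (γ - p) (γ - p) ≤
      noiseBound B C ‖p‖ :=
    (weightedInner_self_le_norm fun i => hnoise.trans (le_proxyDenom hε.le hv i)).trans hnoise
  calc weightedNoise B C ε p v γ ^ 2
      ≤ weightedGradSq B C ε p v
          * weightedInner (proxyDenom ε (noiseBound B C ‖p‖) v) (γ - p) (γ - p) :=
        sq_weightedInner_le fun i => (proxyDenom_pos hε i).le
    _ ≤ weightedGradSq B C ε p v * noiseBound B C ‖p‖ :=
        mul_le_mul_of_nonneg_left hself (weightedGradSq_nonneg hε)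
    _ = noiseBound B C ‖p‖ * weightedGradSq B C ε p v := mul_comm _ _

theorem integral_weightedNoise_eq_zero {Z : Type*} [MeasurableSpace Z] {P : Measure Z}
    [IsProbabilityMeasure P] {γ : Z → EuclideanSpace ℝ ι} (hγ : Integrable γ P)
    (hmean : ∫ z, γ z ∂P = p) : ∫ z, weightedNoise B C ε p v (γ z) ∂P = 0 := by
  have hsub : Integrable (fun z => γ z - p) P := hγ.sub (integrable_const p)
  simp only [weightedNoise]
  rw [integral_weightedInner hsub, integral_sub hγ (integrable_const p),
    hmean, integral_const, probReal_univ, one_smul, sub_self]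
  simp [weightedInner]

end AffineNoise

theorem GeneralizedSmooth.le_of_direction {d : ℕ} {f : EuclideanSpace ℝ (Fin d) → ℝ}
    {L₀ L₁ B C ε η : ℝ} {x v γ : EuclideanSpace ℝ (Fin d)}
    (hf : GeneralizedSmooth f L₀ L₁) (hη : 0 ≤ η) (hηd : η * √d ≤ 1 / L₁) (hε : 0 < ε)
    (hv : ∀ i, 0 ≤ v i) (h : ‖γ - gradient f x‖ ^ 2 ≤ B * ‖gradient f x‖ ^ 2 + C) :
    f (x + -η • direction ε v γ) ≤ f x - 3 / 4 * (η * weightedGradSq B C ε (gradient f x) v)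
      - η * weightedNoise B C ε (gradient f x) v γ
      + (η * noiseBound B C ‖gradient f x‖ + (L₀ + L₁ * ‖gradient f x‖) / 2 * η ^ 2)
        * ‖direction ε v γ‖ ^ 2 := by
  have hnorm : ‖-η • direction ε v γ‖ = η * ‖direction ε v γ‖ := by
    rw [norm_smul, norm_neg, Real.norm_of_nonneg hη]
  have hradius : η * ‖direction ε v γ‖ ≤ 1 / L₁ := by
    refine le_trans (mul_le_mul_of_nonneg_left ?_ hη) hηd
    simpa using norm_direction_le hε.le hv
  have hdescent := hf.le_add_inner_add_sq x (-η • direction ε v γ) (hnorm.trans_le hradius)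
  rw [hnorm, real_inner_smul_right] at hdescent
  have hinner := mul_le_mul_of_nonneg_left
    (le_inner_direction (p := gradient f x) hε hv (norm_le_noiseBound h)) hη
  unfold weightedGradSq weightedNoise
  linarith

end Decoupling

section Trajectory

namespace GeneralizedSmooth

variable {d : ℕ} {f : EuclideanSpace ℝ (Fin d) → ℝ} {fstar L₀ L₁ B C Λ : ℝ}
  {x : EuclideanSpace ℝ (Fin d)}

theorem noiseBound_le_calH (hf : GeneralizedSmooth f L₀ L₁) (hL₀ : 0 < L₀) (hL₁ : 0 < L₁)
    (hB : 0 ≤ B) (hb : BoundedBelowBy f fstar) (hx : f x - fstar ≤ Λ) :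
    noiseBound B C ‖gradient f x‖ ≤ calH L₀ L₁ 0 B C Λ := by
  rw [calH, mul_zero, zero_mul, zero_add]
  exact noiseBound_mono hB (norm_nonneg _) (hf.norm_gradient_le hL₀ hL₁ hb hx)

theorem two_mul_add_mul_norm_gradient_le_calL (hf : GeneralizedSmooth f L₀ L₁) (hL₀ : 0 < L₀)
    (hL₁ : 0 < L₁) (hb : BoundedBelowBy f fstar) (hx : f x - fstar ≤ Λ) :
    2 * (L₀ + L₁ * ‖gradient f x‖) ≤ calL L₀ L₁ Λ := by
  have := mul_le_mul_of_nonneg_left (hf.norm_gradient_le hL₀ hL₁ hb hx) hL₁.le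
  unfold calL
  linarith

end GeneralizedSmooth

theorem sqrt_add_sq_le_sqrt_add_sqrt_add {a b r : ℝ} (ha : 0 ≤ a) (hb : 0 ≤ b) (hr : 0 ≤ r) :
    √(a + b + r ^ 2) ≤ √a + √b + r := by
  refine Real.sqrt_le_iff.2 ⟨by positivity, ?_⟩
  have : 0 ≤ √a * √b + (√a + √b) * r := by positivity
  linarith [Real.sq_sqrt ha, Real.sq_sqrt hb]

theorem le_of_le_mul_sqrt_add {S K a R : ℝ} (hS : 0 ≤ S) (ha : 0 < a)
    (h : S ≤ K * (√(2 * a * S) + R)) : S ≤ 2 * K * (K * a + R) := by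
  have hsqrt : √(2 * a * S) ^ 2 = 2 * a * S := Real.sq_sqrt (by positivity)
  have hamgm : K * √(2 * a * S) ≤ S / 2 + K ^ 2 * a := by
    refine le_of_mul_le_mul_left ?_ ha
    linarith [sq_nonneg (√(2 * a * S) - 2 * (a * K))]
  linarith

variable {d T : ℕ} {f : EuclideanSpace ℝ (Fin d) → ℝ} {fstar L₀ L₁ B C C₀ η ε δ : ℝ}
  {x v γ : ℕ → EuclideanSpace ℝ (Fin d)}

/-- A trajectory `x 0, x 1, …` of AdaGrad along the stochastic gradients `γ 0, γ 1, …`, with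
accumulated squares `v`, on which the affine bound on the noise holds during the first `T` steps. -/
structure IsTrajectory (f : EuclideanSpace ℝ (Fin d) → ℝ) (B C η ε : ℝ) (T : ℕ)
    (x v γ : ℕ → EuclideanSpace ℝ (Fin d)) : Prop where
  zero_v : v 0 = 0
  succ_v : ∀ n i, v (n + 1) i = v n i + γ n i ^ 2
  succ_x : ∀ n, x (n + 1) = x n + -η • direction ε (v n) (γ n)
  noise : ∀ n < T, ‖γ n - gradient f (x n)‖ ^ 2 ≤ B * ‖gradient f (x n)‖ ^ 2 + C

namespace IsTrajectory

theorem v_nonneg (h : IsTrajectory f B C η ε T x v γ) (n : ℕ) (i : Fin d) : 0 ≤ v n i :=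
  accumulated_nonneg h.zero_v h.succ_v n i

theorem v_le (h : IsTrajectory f B C η ε T x v γ) (hB : 0 ≤ B) (hC : 0 ≤ C) {t : ℕ} (ht : t ≤ T)
    (i : Fin d) :
    v t i ≤ 2 * (B + 1) * ∑ n ∈ Finset.range t, ‖gradient f (x n)‖ ^ 2 + 2 * C * t :=
  calc v t i ≤ ∑ n ∈ Finset.range t, ‖γ n‖ ^ 2 := accumulated_le h.zero_v h.succ_v t i
    _ ≤ ∑ n ∈ Finset.range t, (2 * (B + 1) * ‖gradient f (x n)‖ ^ 2 + 2 * C) := by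
        refine Finset.sum_le_sum fun n hn => ?_
        rw [← sq_noiseBound hB hC]
        gcongr
        exact norm_le_noiseBound (h.noise n ((Finset.mem_range.1 hn).trans_le ht))
    _ = 2 * (B + 1) * ∑ n ∈ Finset.range t, ‖gradient f (x n)‖ ^ 2 + 2 * C * t := by
        rw [Finset.sum_add_distrib, ← Finset.mul_sum, Finset.sum_const, Finset.card_range,
          nsmul_eq_mul, mul_comm (t : ℝ)]

theorem norm_sub_succ_le (h : IsTrajectory f B C η ε T x v γ) (hη : 0 ≤ η) (hε : 0 ≤ ε) (n : ℕ) :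
    ‖x n - x (n + 1)‖ ≤ η * √d := by
  rw [h.succ_x, sub_add_cancel_left, norm_neg, norm_smul, norm_neg, Real.norm_of_nonneg hη]
  refine mul_le_mul_of_nonneg_left ?_ hη
  simpa using norm_direction_le (γ := γ n) hε (h.v_nonneg n)

theorem norm_gradient_le_linear (h : IsTrajectory f B C η ε T x v γ)
    (hf : GeneralizedSmooth f L₀ L₁) (hL₀ : 0 ≤ L₀) (hL₁ : 0 ≤ L₁) (hη : 0 ≤ η)
    (hηd : η * √d ≤ 1 / L₁) (hε : 0 ≤ ε) {n : ℕ}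
    (hC₀ : ∀ k < n, η * (L₀ + L₁ * ‖gradient f (x k)‖) ≤ C₀) :
    ‖gradient f (x n)‖ ≤ ‖gradient f (x 0)‖ + C₀ * √d * n := by
  induction n with
  | zero => simp
  | succ n ih =>
    have hstep : ‖x n - x (n + 1)‖ ≤ η * √d := h.norm_sub_succ_le hη hε n
    have hincrement : ‖gradient f (x (n + 1)) - gradient f (x n)‖ ≤ C₀ * √d :=
      calc ‖gradient f (x (n + 1)) - gradient f (x n)‖
          ≤ (L₀ + L₁ * ‖gradient f (x n)‖) * ‖x n - x (n + 1)‖ := hf.2 _ _ (hstep.trans hηd)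
        _ ≤ (L₀ + L₁ * ‖gradient f (x n)‖) * (η * √d) := by gcongr
        _ = η * (L₀ + L₁ * ‖gradient f (x n)‖) * √d := by ring
        _ ≤ C₀ * √d := by
          gcongr
          exact hC₀ n n.lt_succ_self
    have htriangle := norm_sub_norm_le (gradient f (x (n + 1))) (gradient f (x n))
    have hpast := ih fun k hk => hC₀ k (hk.trans n.lt_succ_self)
    push_cast
    linarith

theorem sum_sq_norm_direction_le_log_polyJ (h : IsTrajectory f B C η ε T x v γ) (hB : 0 ≤ B)
    (hC : 0 ≤ C) (hC₀ : 0 ≤ C₀) (hε : 0 < ε) {t : ℕ} (ht : t ≤ T)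
    (hgrad : ∀ n < t, ‖gradient f (x n)‖ ≤ ‖gradient f (x 0)‖ + C₀ * √d * n) :
    ∑ n ∈ Finset.range t, ‖direction ε (v n) (γ n)‖ ^ 2 ≤
      d * Real.log (polyJ d T B C C₀ ε ‖gradient f (x 0)‖) := by
  set M := ‖gradient f (x 0)‖ + C₀ * √d * T with hM
  have htT : (t : ℝ) ≤ T := by exact_mod_cast ht
  have hsum : ∑ n ∈ Finset.range t, ‖gradient f (x n)‖ ^ 2 ≤ T * M ^ 2 :=
    calc ∑ n ∈ Finset.range t, ‖gradient f (x n)‖ ^ 2 ≤ ∑ n ∈ Finset.range t, M ^ 2 := by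
          refine Finset.sum_le_sum fun n hn => ?_
          have hn' := Finset.mem_range.1 hn
          have hnT : (n : ℝ) ≤ T := by exact_mod_cast (hn'.trans_le ht).le
          gcongr
          exact (hgrad n hn').trans (by rw [hM]; gcongr)
      _ = t * M ^ 2 := by rw [Finset.sum_const, Finset.card_range, nsmul_eq_mul]
      _ ≤ T * M ^ 2 := by gcongr
  have hv (i : Fin d) : v t i ≤ 2 * (B + 1) * M ^ 2 * T + 2 * C * T :=
    calc v t i ≤ 2 * (B + 1) * ∑ n ∈ Finset.range t, ‖gradient f (x n)‖ ^ 2 + 2 * C * t :=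
          h.v_le hB hC ht i
      _ ≤ 2 * (B + 1) * (T * M ^ 2) + 2 * C * T := by gcongr
      _ = 2 * (B + 1) * M ^ 2 * T + 2 * C * T := by ring
  have hJ (i : Fin d) : 1 + v t i / ε ^ 2 ≤ polyJ d T B C C₀ ε ‖gradient f (x 0)‖ := by
    rw [polyJ, ← hM, div_eq_inv_mul, ← one_div]
    gcongr
    exact hv i
  simpa using sum_sq_norm_direction_le hε h.zero_v h.succ_v hJ

theorem sum_descent (h : IsTrajectory f B C η ε T x v γ) (hf : GeneralizedSmooth f L₀ L₁)
    (hη : 0 ≤ η) (hηd : η * √d ≤ 1 / L₁) (hε : 0 < ε) {t : ℕ} (ht : t ≤ T) {c : ℝ}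
    (hc : ∀ n < t, η * noiseBound B C ‖gradient f (x n)‖
      + (L₀ + L₁ * ‖gradient f (x n)‖) / 2 * η ^ 2 ≤ c) :
    f (x t) ≤ f (x 0)
      - 3 / 4 * (η * ∑ n ∈ Finset.range t, weightedGradSq B C ε (gradient f (x n)) (v n))
      - η * ∑ n ∈ Finset.range t, weightedNoise B C ε (gradient f (x n)) (v n) (γ n)
      + c * ∑ n ∈ Finset.range t, ‖direction ε (v n) (γ n)‖ ^ 2 := by
  induction t with
  | zero => simp
  | succ t ih =>
    have hpast := ih (Nat.le_of_succ_le ht) fun n hn => hc n (hn.trans t.lt_succ_self)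
    have hstep := hf.le_of_direction hη hηd hε (h.v_nonneg t) (h.noise t ht)
    rw [← h.succ_x] at hstep
    have hcoeff := mul_le_mul_of_nonneg_right (hc t t.lt_succ_self)
      (sq_nonneg ‖direction ε (v t) (γ t)‖)
    simp only [Finset.sum_range_succ]
    linarith

theorem sum_noiseBound_mul_weightedGradSq_le (hC₀ : 0 < C₀) (hη : 0 ≤ η) (hε : 0 < ε) {t : ℕ}
    (hH : ∀ n < t, η * noiseBound B C ‖gradient f (x n)‖ ≤ C₀) :
    η ^ 2 / (6 * C₀) * ∑ n ∈ Finset.range t,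
        noiseBound B C ‖gradient f (x n)‖ * weightedGradSq B C ε (gradient f (x n)) (v n) ≤
      1 / 6 * (η * ∑ n ∈ Finset.range t, weightedGradSq B C ε (gradient f (x n)) (v n)) := by
  simp only [Finset.mul_sum]
  refine Finset.sum_le_sum fun n hn => ?_
  set r := noiseBound B C ‖gradient f (x n)‖
  set W := weightedGradSq B C ε (gradient f (x n)) (v n)
  have hW : 0 ≤ W := weightedGradSq_nonneg hε
  calc η ^ 2 / (6 * C₀) * (r * W) = η * r / C₀ * (1 / 6 * (η * W)) := by
        field_simp
    _ ≤ 1 * (1 / 6 * (η * W)) := by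
        gcongr
        exact div_le_one_of_le₀ (hH n (Finset.mem_range.1 hn)) hC₀.le
    _ = 1 / 6 * (η * W) := one_mul _

theorem energy_le_of_small_steps (h : IsTrajectory f B C η ε T x v γ)
    (hf : GeneralizedSmooth f L₀ L₁) (hL₀ : 0 ≤ L₀) (hL₁ : 0 ≤ L₁) (hB : 0 ≤ B) (hC : 0 ≤ C)
    (hC₀ : 0 < C₀) (hη : 0 ≤ η) (hε : 0 < ε) (hηC₀ : η ≤ C₀) (hηd : η * √d ≤ 1 / L₁)
    {t : ℕ} (ht : t ≤ T) (hH : ∀ n < t, η * noiseBound B C ‖gradient f (x n)‖ ≤ C₀)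
    (hL : ∀ n < t, η * (2 * (L₀ + L₁ * ‖gradient f (x n)‖)) ≤ C₀)
    (hmart : -(η * ∑ n ∈ Finset.range t, weightedNoise B C ε (gradient f (x n)) (v n) (γ n)) ≤
      η ^ 2 / (6 * C₀) * ∑ n ∈ Finset.range t,
        noiseBound B C ‖gradient f (x n)‖ * weightedGradSq B C ε (gradient f (x n)) (v n)
      + 3 * C₀ * Real.log (T / δ)) :
    f (x t) - fstar
      + η / 2 * ∑ n ∈ Finset.range t, weightedGradSq B C ε (gradient f (x n)) (v n) ≤
      LambdaY d T B C C₀ ε δ (f (x 0) - fstar) ‖gradient f (x 0)‖ := by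
  have hL' (n : ℕ) (hn : n < t) : η * (L₀ + L₁ * ‖gradient f (x n)‖) ≤ C₀ / 2 := by
    linarith [hL n hn]
  have hlin (n : ℕ) (hn : n < t) :
      ‖gradient f (x n)‖ ≤ ‖gradient f (x 0)‖ + C₀ * √d * n :=
    h.norm_gradient_le_linear hf hL₀ hL₁ hη hηd hε.le fun k hk =>
      (hL' k (hk.trans hn)).trans (half_le_self hC₀.le)
  have hcoeff (n : ℕ) (hn : n < t) : η * noiseBound B C ‖gradient f (x n)‖
      + (L₀ + L₁ * ‖gradient f (x n)‖) / 2 * η ^ 2 ≤ C₀ + C₀ ^ 2 / 4 := by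
    have := mul_le_mul (hL' n hn) hηC₀ hη (by positivity)
    linarith [hH n hn]
  have hdescent := h.sum_descent hf hη hηd hε ht hcoeff
  have hlog := mul_le_mul_of_nonneg_left
    (h.sum_sq_norm_direction_le_log_polyJ hB hC hC₀.le hε ht hlin)
    (by positivity : 0 ≤ C₀ + C₀ ^ 2 / 4)
  have hvariance := sum_noiseBound_mul_weightedGradSq_le (v := v) hC₀ hη hε hH
  have hW : 0 ≤ η * ∑ n ∈ Finset.range t, weightedGradSq B C ε (gradient f (x n)) (v n) :=
    mul_nonneg hη (Finset.sum_nonneg fun n _ => weightedGradSq_nonneg hε)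
  have hJ : 0 ≤ C₀ ^ 2 * d * Real.log (polyJ d T B C C₀ ε ‖gradient f (x 0)‖) :=
    mul_nonneg (by positivity) (log_polyJ_nonneg hB hC)
  rw [LambdaY_eq]
  linarith

theorem energy_le (h : IsTrajectory f B C η ε T x v γ) (hf : GeneralizedSmooth f L₀ L₁)
    (hb : BoundedBelowBy f fstar) (hL₀ : 0 < L₀) (hL₁ : 0 < L₁) (hB : 0 ≤ B) (hC : 0 ≤ C)
    (hC₀ : 0 < C₀) (hη : 0 ≤ η) (hε : 0 < ε) {Λ : ℝ}
    (hΛ : LambdaY d T B C C₀ ε δ (f (x 0) - fstar) ‖gradient f (x 0)‖ ≤ Λ) (hηC₀ : η ≤ C₀)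
    (hηH : η * calH L₀ L₁ 0 B C Λ ≤ C₀) (hηL : η * calL L₀ L₁ Λ ≤ C₀) (hηd : η * √d ≤ 1 / L₁)
    (hmart : ∀ t ≤ T,
      -(η * ∑ n ∈ Finset.range t, weightedNoise B C ε (gradient f (x n)) (v n) (γ n)) ≤
      η ^ 2 / (6 * C₀) * ∑ n ∈ Finset.range t,
        noiseBound B C ‖gradient f (x n)‖ * weightedGradSq B C ε (gradient f (x n)) (v n)
      + 3 * C₀ * Real.log (T / δ)) {t : ℕ} (ht : t ≤ T) :
    f (x t) - fstar
      + η / 2 * ∑ n ∈ Finset.range t, weightedGradSq B C ε (gradient f (x n)) (v n) ≤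
      LambdaY d T B C C₀ ε δ (f (x 0) - fstar) ‖gradient f (x 0)‖ := by
  induction t using Nat.strong_induction_on with
  | _ t ih =>
  have hgap (n : ℕ) (hn : n < t) : f (x n) - fstar ≤ Λ := by
    have hW : 0 ≤ η / 2 * ∑ k ∈ Finset.range n,
        weightedGradSq B C ε (gradient f (x k)) (v k) :=
      mul_nonneg (by positivity) (Finset.sum_nonneg fun k _ => weightedGradSq_nonneg hε)
    linarith [ih n hn (hn.le.trans ht)]
  refine h.energy_le_of_small_steps hf hL₀.le hL₁.le hB hC hC₀ hη hε hηC₀ hηd ht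
    (fun n hn => le_trans ?_ hηH) (fun n hn => le_trans ?_ hηL) (hmart t ht)
  · exact mul_le_mul_of_nonneg_left (hf.noiseBound_le_calH hL₀ hL₁ hB hb (hgap n hn)) hη
  · exact mul_le_mul_of_nonneg_left
      (hf.two_mul_add_mul_norm_gradient_le_calL hL₀ hL₁ hb (hgap n hn)) hη

theorem proxyDenom_le (h : IsTrajectory f B C η ε T x v γ) (hB : 0 ≤ B) (hC : 0 ≤ C) {H : ℝ}
    {n : ℕ} (hn : n ≤ T) (hH : noiseBound B C ‖gradient f (x n)‖ ≤ H) (i : Fin d) :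
    proxyDenom ε (noiseBound B C ‖gradient f (x n)‖) (v n) i ≤
      √(2 * (B + 1) * ∑ k ∈ Finset.range T, ‖gradient f (x k)‖ ^ 2) + √(2 * C * T) + H + ε := by
  have hv : v n i ≤ 2 * (B + 1) * ∑ k ∈ Finset.range T, ‖gradient f (x k)‖ ^ 2 + 2 * C * T := by
    refine (h.v_le hB hC hn i).trans ?_
    gcongr
  have hr := noiseBound_nonneg B C ‖gradient f (x n)‖
  calc proxyDenom ε (noiseBound B C ‖gradient f (x n)‖) (v n) i
      ≤ √(2 * (B + 1) * ∑ k ∈ Finset.range T, ‖gradient f (x k)‖ ^ 2 + 2 * C * T + H ^ 2) + ε := by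
        unfold proxyDenom
        gcongr
    _ ≤ √(2 * (B + 1) * ∑ k ∈ Finset.range T, ‖gradient f (x k)‖ ^ 2) + √(2 * C * T) + H + ε := by
        gcongr
        exact sqrt_add_sq_le_sqrt_add_sqrt_add (by positivity) (by positivity) (hr.trans hH)

theorem sum_sq_norm_gradient_le (h : IsTrajectory f B C η ε T x v γ) (hT : 0 < T) (hB : 0 ≤ B)
    (hC : 0 ≤ C) (hη : 0 < η) (hε : 0 < ε) {Λ H : ℝ}
    (hH : ∀ n < T, noiseBound B C ‖gradient f (x n)‖ ≤ H)
    (hΛ : η / 2 * ∑ n ∈ Finset.range T, weightedGradSq B C ε (gradient f (x n)) (v n) ≤ Λ) :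
    ∑ n ∈ Finset.range T, ‖gradient f (x n)‖ ^ 2 ≤
      4 * Λ / η * (2 * Λ * (B + 1) / η + H + ε + √(2 * C * T)) := by
  set S := ∑ n ∈ Finset.range T, ‖gradient f (x n)‖ ^ 2
  have hS0 : 0 ≤ S := Finset.sum_nonneg fun _ _ => sq_nonneg _
  have hH0 : 0 ≤ H := (noiseBound_nonneg B C _).trans (hH 0 hT)
  have hW : ∑ n ∈ Finset.range T, weightedGradSq B C ε (gradient f (x n)) (v n) ≤ 2 * Λ / η := by
    rw [le_div_iff₀ hη]
    linarith
  have hself : S ≤ 2 * Λ / η * (√(2 * (B + 1) * S) + (√(2 * C * T) + H + ε)) :=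
    calc S ≤ ∑ n ∈ Finset.range T, (√(2 * (B + 1) * S) + √(2 * C * T) + H + ε)
            * weightedGradSq B C ε (gradient f (x n)) (v n) :=
          Finset.sum_le_sum fun n hn => sq_norm_le_mul_weightedInner_self (proxyDenom_pos hε)
            (h.proxyDenom_le hB hC (Finset.mem_range.1 hn).le (hH n (Finset.mem_range.1 hn)))
      _ ≤ (√(2 * (B + 1) * S) + √(2 * C * T) + H + ε) * (2 * Λ / η) := by
          rw [← Finset.mul_sum]
          gcongr
      _ = 2 * Λ / η * (√(2 * (B + 1) * S) + (√(2 * C * T) + H + ε)) := by ring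
  refine (le_of_le_mul_sqrt_add hS0 (by positivity) hself).trans_eq ?_
  ring

theorem mean_sq_norm_gradient_le (h : IsTrajectory f B C η ε T x v γ)
    (hf : GeneralizedSmooth f L₀ L₁) (hb : BoundedBelowBy f fstar) (hT : 0 < T) (hL₀ : 0 < L₀)
    (hL₁ : 0 < L₁) (hB : 0 ≤ B) (hC : 0 ≤ C) (hC₀ : 0 < C₀) (hη : 0 < η) (hε : 0 < ε) {Λ Y : ℝ}
    (hY : LambdaY d T B C C₀ ε δ (f (x 0) - fstar) ‖gradient f (x 0)‖ = Y) (hYΛ : Y ≤ Λ)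
    (hηC₀ : η ≤ C₀) (hηH : η * calH L₀ L₁ 0 B C Λ ≤ C₀) (hηL : η * calL L₀ L₁ Λ ≤ C₀)
    (hηd : η * √d ≤ 1 / L₁)
    (hmart : ∀ t ≤ T,
      -(η * ∑ n ∈ Finset.range t, weightedNoise B C ε (gradient f (x n)) (v n) (γ n)) ≤
      η ^ 2 / (6 * C₀) * ∑ n ∈ Finset.range t,
        noiseBound B C ‖gradient f (x n)‖ * weightedGradSq B C ε (gradient f (x n)) (v n)
      + 3 * C₀ * Real.log (T / δ)) :
    (1 / T : ℝ) * ∑ n ∈ Finset.range T, ‖gradient f (x n)‖ ^ 2 ≤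
      4 * Y / η * ((2 * Y * (B + 1) / η + calH L₀ L₁ 0 B C Λ + ε) / T + √(2 * C / T)) := by
  have hT' : (0 : ℝ) < T := by exact_mod_cast hT
  have henergy (t : ℕ) (ht : t ≤ T) : f (x t) - fstar
      + η / 2 * ∑ n ∈ Finset.range t, weightedGradSq B C ε (gradient f (x n)) (v n) ≤ Y :=
    (h.energy_le hf hb hL₀ hL₁ hB hC hC₀ hη.le hε (hY.trans_le hYΛ) hηC₀ hηH hηL hηd hmart
      ht).trans_eq hY
  have hW (t : ℕ) : 0 ≤ η / 2 * ∑ n ∈ Finset.range t,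
      weightedGradSq B C ε (gradient f (x n)) (v n) :=
    mul_nonneg (by positivity) (Finset.sum_nonneg fun n _ => weightedGradSq_nonneg hε)
  have hH (n : ℕ) (hn : n < T) : noiseBound B C ‖gradient f (x n)‖ ≤ calH L₀ L₁ 0 B C Λ :=
    hf.noiseBound_le_calH hL₀ hL₁ hB hb (by linarith [henergy n hn.le, hW n])
  have hsum := h.sum_sq_norm_gradient_le hT hB hC hη hε (Λ := Y) hH
    (by linarith [henergy T le_rfl, hb (x T)])
  have hsqrt : √(2 * C * T) = √(2 * C / T) * T := by
    rw [show 2 * C * (T : ℝ) = 2 * C / T * T ^ 2 by field_simp, Real.sqrt_mul (by positivity),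
      Real.sqrt_sq hT'.le]
  rw [one_div, inv_mul_le_iff₀ hT']
  refine hsum.trans_eq ?_
  rw [hsqrt]
  field_simp

end IsTrajectory

end Trajectory

section Sampling

theorem exists_measurable_eq_comp_restrict {ι Z E : Type*} [MeasurableSpace Z] [MeasurableSpace E]
    [hne : Nonempty (ι → Z)] {X : (ι → Z) → E} {S : Finset ι} (hXm : Measurable X)
    (hX : DependsOn X S) : ∃ Y : (S → Z) → E, Measurable Y ∧ X = Y ∘ S.restrict := by
  classical
  obtain ⟨c⟩ := hne
  exact ⟨X ∘ Function.updateFinset c S, hXm.comp measurable_updateFinset,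
    funext fun u => hX fun i hi => by simp [Function.updateFinset, Finset.mem_coe.1 hi]⟩

/-- The random variables `z i`, for `i ∈ I`, are independent samples of the law `P`. Nothing is
assumed of `z i` for the other indices, not even measurability. -/
structure IsIIDSample {ι Ω Z : Type*} [MeasurableSpace Ω] [MeasurableSpace Z] (z : ι → Ω → Z)
    (I : Finset ι) (P : Measure Z) (μ : Measure Ω) : Prop where
  measurable : ∀ i ∈ I, Measurable (z i)
  map_eq : ∀ i ∈ I, μ.map (z i) = P
  indep : iIndepFun (fun i : I => z i) μ

namespace IsIIDSample

variable {ι Ω Z E : Type*} [MeasurableSpace Ω] [MeasurableSpace Z] [MeasurableSpace E]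
  {z : ι → Ω → Z} {I S : Finset ι} {j : ι} {P : Measure Z} {μ : Measure Ω}
  [IsProbabilityMeasure μ] {X : (ι → Z) → E}

theorem isProbabilityMeasure_law (h : IsIIDSample z I P μ) (hj : j ∈ I) :
    IsProbabilityMeasure P := by
  rw [← h.map_eq j hj]
  exact Measure.isProbabilityMeasure_map (h.measurable j hj).aemeasurable

theorem measurable_comp (h : IsIIDSample z I P μ) (hSI : S ⊆ I) (hXm : Measurable X)
    (hX : DependsOn X S) : Measurable fun ω => X (z · ω) := by
  have : Nonempty (ι → Z) := (nonempty_of_isProbabilityMeasure μ).map fun ω => (z · ω)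
  obtain ⟨Y, hY, rfl⟩ := exists_measurable_eq_comp_restrict hXm hX
  exact hY.comp (measurable_pi_iff.2 fun i => h.measurable i (hSI i.2))

theorem indepFun_comp (h : IsIIDSample z I P μ) (hSI : S ⊆ I) (hj : j ∈ I) (hjS : j ∉ S)
    (hXm : Measurable X) (hX : DependsOn X S) : IndepFun (fun ω => X (z · ω)) (z j) μ := by
  classical
  have : Nonempty (ι → Z) := (nonempty_of_isProbabilityMeasure μ).map fun ω => (z · ω)
  obtain ⟨Y, hY, rfl⟩ := exists_measurable_eq_comp_restrict hXm hX
  have hdisj : Disjoint (S.subtype (· ∈ I)) {⟨j, hj⟩} := by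
    simpa using hjS
  have hblocks := h.indep.indepFun_finset _ _ hdisj fun i => h.measurable i i.2
  have hreindex : Measurable fun (a : S.subtype (· ∈ I) → Z) (i : S) =>
      a ⟨⟨i, hSI i.2⟩, Finset.mem_subtype.2 i.2⟩ :=
    measurable_pi_iff.2 fun _ => measurable_pi_apply _
  exact hblocks.comp (hY.comp hreindex)
    (measurable_pi_apply ⟨⟨j, hj⟩, Finset.mem_singleton_self _⟩)

theorem map_prodMk_eq (h : IsIIDSample z I P μ) (hSI : S ⊆ I) (hj : j ∈ I) (hjS : j ∉ S)
    (hXm : Measurable X) (hX : DependsOn X S) :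
    μ.map (fun ω => (X (z · ω), z j ω)) = (μ.map fun ω => X (z · ω)).prod P := by
  rw [(indepFun_iff_map_prod_eq_prod_map_map (h.measurable_comp hSI hXm hX).aemeasurable
    (h.measurable j hj).aemeasurable).1 (h.indepFun_comp hSI hj hjS hXm hX), h.map_eq j hj]

theorem lintegral_comp_prodMk (h : IsIIDSample z I P μ) (hSI : S ⊆ I) (hj : j ∈ I) (hjS : j ∉ S)
    (hXm : Measurable X) (hX : DependsOn X S) {K : E × Z → ENNReal} (hK : Measurable K) :
    ∫⁻ ω, K (X (z · ω), z j ω) ∂μ = ∫⁻ ω, ∫⁻ w, K (X (z · ω), w) ∂P ∂μ := by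
  have := h.isProbabilityMeasure_law hj
  have hX' := h.measurable_comp hSI hXm hX
  rw [← lintegral_map hK (hX'.prodMk (h.measurable j hj)), h.map_prodMk_eq hSI hj hjS hXm hX,
    lintegral_prod _ hK.aemeasurable, lintegral_map hK.lintegral_prod_right' hX']

theorem ae_comp_prodMk (h : IsIIDSample z I P μ) (hSI : S ⊆ I) (hj : j ∈ I) (hjS : j ∉ S)
    (hXm : Measurable X) (hX : DependsOn X S) {p : E × Z → Prop} (hp : MeasurableSet {q | p q})
    (hae : ∀ e, ∀ᵐ w ∂P, p (e, w)) : ∀ᵐ ω ∂μ, p (X (z · ω), z j ω) := by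
  have := h.isProbabilityMeasure_law hj
  have hpair := (h.measurable_comp hSI hXm hX).prodMk (h.measurable j hj)
  refine ae_of_ae_map hpair.aemeasurable ?_
  rw [h.map_prodMk_eq hSI hj hjS hXm hX]
  exact (Measure.ae_prod_iff_ae_ae hp).2 (Filter.Eventually.of_forall hae)

end IsIIDSample

end Sampling

section ExponentialMartingale

variable {Ω Z E : Type*} [MeasurableSpace Ω] {μ : Measure Ω}

theorem measure_exists_log_card_div_lt_le {ι : Type*} {s : Finset ι} {Y : ι → Ω → ℝ}
    (hYm : ∀ i ∈ s, Measurable (Y i)) (hY : ∀ i ∈ s, ∫⁻ ω, .ofReal (Real.exp (Y i ω)) ∂μ ≤ 1)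
    {δ : ℝ} (hδ : 0 < δ) :
    μ {ω | ∃ i ∈ s, Real.log (s.card / δ) < Y i ω} ≤ ENNReal.ofReal δ := by
  rcases s.eq_empty_or_nonempty with rfl | hs
  · simp
  have hcard : (0 : ℝ) < s.card := by exact_mod_cast hs.card_pos
  have hpos : 0 < s.card / δ := by positivity
  have htail (i : ι) (hi : i ∈ s) :
      μ {ω | Real.log (s.card / δ) < Y i ω} ≤ ENNReal.ofReal (δ / s.card) :=
    calc μ {ω | Real.log (s.card / δ) < Y i ω}
        ≤ μ {ω | ENNReal.ofReal (s.card / δ) ≤ ENNReal.ofReal (Real.exp (Y i ω))} :=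
          measure_mono fun ω hω =>
            ENNReal.ofReal_le_ofReal ((Real.log_lt_iff_lt_exp hpos).1 hω).le
      _ ≤ (∫⁻ ω, ENNReal.ofReal (Real.exp (Y i ω)) ∂μ) / ENNReal.ofReal (s.card / δ) :=
          meas_ge_le_lintegral_div (hYm i hi).exp.ennreal_ofReal.aemeasurable
            (by simpa using hpos) ENNReal.ofReal_ne_top
      _ ≤ 1 / ENNReal.ofReal (s.card / δ) := by
          gcongr
          exact hY i hi
      _ = ENNReal.ofReal (δ / s.card) := by
          rw [one_div, ← ENNReal.ofReal_inv_of_pos hpos, inv_div]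
  calc μ {ω | ∃ i ∈ s, Real.log (s.card / δ) < Y i ω}
      = μ (⋃ i ∈ s, {ω | Real.log (s.card / δ) < Y i ω}) := by
        congr 1
        ext ω
        simp
    _ ≤ ∑ _ ∈ s, ENNReal.ofReal (δ / s.card) :=
        (measure_biUnion_finset_le _ _).trans (Finset.sum_le_sum htail)
    _ = ENNReal.ofReal δ := by
        rw [Finset.sum_const, nsmul_eq_mul, ← ENNReal.ofReal_natCast,
          ← ENNReal.ofReal_mul hcard.le, mul_div_cancel₀ _ hcard.ne']

theorem lintegral_exp_mul_sub_le_one [IsProbabilityMeasure μ] {Y : Ω → ℝ} {σ2 : ℝ}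
    (hYm : AEMeasurable Y μ) (hσ2 : 0 ≤ σ2) (hbound : ∀ᵐ ω ∂μ, Y ω ^ 2 ≤ σ2)
    (hmean : ∫ ω, Y ω ∂μ = 0) (c : ℝ) :
    ∫⁻ ω, .ofReal (Real.exp (c * Y ω - c ^ 2 / 2 * σ2)) ∂μ ≤ 1 := by
  have hsub := hasSubgaussianMGF_of_mem_Icc_of_integral_eq_zero hYm
    (hbound.mono fun ω hω => abs_le.1 (Real.abs_le_sqrt hω)) hmean
  have hproxy : (((‖√σ2 - -√σ2‖₊ / 2) ^ 2 : NNReal) : ℝ) = σ2 := by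
    push_cast
    rw [sub_neg_eq_add, Real.norm_of_nonneg (by positivity), ← two_mul,
      mul_div_cancel_left₀ _ two_ne_zero, Real.sq_sqrt hσ2]
  have hmgf : ∫ ω, Real.exp (c * Y ω) ∂μ ≤ Real.exp (c ^ 2 / 2 * σ2) := by
    refine (hsub.mgf_le c).trans_eq ?_
    rw [hproxy]
    ring_nf
  simp only [Real.exp_sub]
  rw [← ofReal_integral_eq_lintegral_ofReal ((hsub.integrable_exp_mul c).div_const _)
    (Filter.Eventually.of_forall fun ω => by positivity), integral_div]
  exact ENNReal.ofReal_le_one.2 (div_le_one_of_le₀ hmgf (Real.exp_nonneg _))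

/-- The process that accumulates the increments `X e w`, where `w` is the sample drawn in the
state `e`, and where `S n u` is the state after the samples `u 1, …, u n`. -/
def pathSum (X : E → Z → ℝ) (S : ℕ → (ℕ → Z) → E) (t : ℕ) (u : ℕ → Z) : ℝ :=
  ∑ n ∈ Finset.range t, X (S n u) (u (n + 1))

variable {X : E → Z → ℝ} {S : ℕ → (ℕ → Z) → E}

theorem dependsOn_pathSum (hS : ∀ n, DependsOn (S n) (Finset.Icc 1 n)) (t : ℕ) :
    DependsOn (pathSum X S t) (Finset.Icc 1 t) := by
  refine fun u u' huu' => Finset.sum_congr rfl fun n hn => ?_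
  have hnt : n + 1 ≤ t := Finset.mem_range.1 hn
  rw [hS n fun k hk => huu' k (Finset.Icc_subset_Icc_right (Nat.le_of_succ_le hnt) hk),
    huu' (n + 1) (Finset.mem_Icc.2 ⟨n.succ_pos, hnt⟩)]

variable [MeasurableSpace Z] [MeasurableSpace E]

theorem measurable_pathSum (hX : Measurable (Function.uncurry X)) (hS : ∀ n, Measurable (S n))
    (t : ℕ) : Measurable (pathSum X S t) :=
  Finset.measurable_fun_sum _ fun n _ => hX.comp ((hS n).prodMk (measurable_pi_apply (n + 1)))

theorem lintegral_exp_pathSum_le_one [IsProbabilityMeasure μ] {P : Measure Z} {T : ℕ}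
    {z : ℕ → Ω → Z} (hz : IsIIDSample z (Finset.Icc 1 T) P μ)
    (hX : Measurable (Function.uncurry X)) (hSm : ∀ n, Measurable (S n))
    (hS : ∀ n, DependsOn (S n) (Finset.Icc 1 n))
    (hexp : ∀ n u, ∫⁻ w, .ofReal (Real.exp (X (S n u) w)) ∂P ≤ 1) {t : ℕ} (ht : t ≤ T) :
    ∫⁻ ω, .ofReal (Real.exp (pathSum X S t (z · ω))) ∂μ ≤ 1 := by
  induction t with
  | zero => simp [pathSum]
  | succ t ih =>
    have hfactor (e : E) : Measurable fun w => ENNReal.ofReal (Real.exp (X e w)) :=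
      (hX.comp measurable_prodMk_left).exp.ennreal_ofReal
    have hpast : Measurable fun u => (pathSum X S t u, S t u) :=
      (measurable_pathSum hX hSm t).prodMk (hSm t)
    have hlocal : DependsOn (fun u => (pathSum X S t u, S t u)) (Finset.Icc 1 t) :=
      fun u u' huu' => Prod.ext (dependsOn_pathSum hS t huu') (hS t huu')
    calc ∫⁻ ω, .ofReal (Real.exp (pathSum X S (t + 1) (z · ω))) ∂μ
        = ∫⁻ ω, .ofReal (Real.exp (pathSum X S t (z · ω)))
            * .ofReal (Real.exp (X (S t (z · ω)) (z (t + 1) ω))) ∂μ := by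
          simp only [pathSum, Finset.sum_range_succ, Real.exp_add,
            ENNReal.ofReal_mul (Real.exp_nonneg _)]
      _ = ∫⁻ ω, ∫⁻ w, .ofReal (Real.exp (pathSum X S t (z · ω)))
            * .ofReal (Real.exp (X (S t (z · ω)) w)) ∂P ∂μ :=
          hz.lintegral_comp_prodMk (Finset.Icc_subset_Icc_right (Nat.le_of_succ_le ht))
            (Finset.mem_Icc.2 ⟨t.succ_pos, ht⟩) (by simp) hpast hlocal
            (K := fun q => .ofReal (Real.exp q.1.1) * .ofReal (Real.exp (X q.1.2 q.2)))
            (by fun_prop)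
      _ ≤ ∫⁻ ω, .ofReal (Real.exp (pathSum X S t (z · ω))) ∂μ := by
          refine lintegral_mono fun ω => ?_
          rw [lintegral_const_mul _ (hfactor _)]
          exact mul_le_of_le_one_right' (hexp t _)
      _ ≤ 1 := ih (Nat.le_of_succ_le ht)

end ExponentialMartingale

section Concentration

variable {d : ℕ} {Z : Type*} {f : EuclideanSpace ℝ (Fin d) → ℝ}
  {g : EuclideanSpace ℝ (Fin d) → Z → EuclideanSpace ℝ (Fin d)}
  {B C C₀ η ε c : ℝ} {x₁ : EuclideanSpace ℝ (Fin d)}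

/-- The pair `(x_{n+1}, v_n)` after `n` iterations of AdaGrad without momentum; by itself, it
determines the next iteration. -/
def plainState (g : EuclideanSpace ℝ (Fin d) → Z → EuclideanSpace ℝ (Fin d)) (η ε : ℝ)
    (x₁ : EuclideanSpace ℝ (Fin d)) (n : ℕ) (u : ℕ → Z) :
    EuclideanSpace ℝ (Fin d) × EuclideanSpace ℝ (Fin d) :=
  ((state g 0 η ε x₁ u n).x, (state g 0 η ε x₁ u n).v)

theorem plainState_succ (n : ℕ) (u : ℕ → Z) :
    plainState g η ε x₁ (n + 1) u =
      let S := plainState g η ε x₁ n u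
      let γ := g S.1 (u (n + 1))
      (S.1 + -η • direction ε S.2 γ, WithLp.toLp 2 fun i => S.2 i + γ i ^ 2) := by
  refine Prod.ext ?_ rfl
  ext i
  simp [plainState, state, step, direction, mul_div_assoc]

theorem isTrajectory_plainState {T : ℕ} {u : ℕ → Z}
    (h : ∀ n < T, ‖g (plainState g η ε x₁ n u).1 (u (n + 1))
        - gradient f (plainState g η ε x₁ n u).1‖ ^ 2
      ≤ B * ‖gradient f (plainState g η ε x₁ n u).1‖ ^ 2 + C) :
    IsTrajectory f B C η ε T (fun n => (plainState g η ε x₁ n u).1)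
      (fun n => (plainState g η ε x₁ n u).2)
      (fun n => g (plainState g η ε x₁ n u).1 (u (n + 1))) where
  zero_v := rfl
  succ_v _ _ := rfl
  succ_x n := by rw [plainState_succ]
  noise := h

theorem plainState_snd_nonneg (n : ℕ) (u : ℕ → Z) (i : Fin d) :
    0 ≤ (plainState g η ε x₁ n u).2 i :=
  accumulated_nonneg (v := fun n => (plainState g η ε x₁ n u).2)
    (γ := fun n => g (plainState g η ε x₁ n u).1 (u (n + 1))) rfl (fun _ _ => rfl) n i

theorem dependsOn_plainState (n : ℕ) :
    DependsOn (plainState g η ε x₁ n) (Finset.Icc 1 n) := by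
  induction n with
  | zero => exact fun _ _ _ => rfl
  | succ n ih =>
    intro u u' huu'
    have hpast := ih fun k hk => huu' k (Finset.Icc_subset_Icc_right n.le_succ hk)
    rw [plainState_succ, plainState_succ, hpast,
      huu' (n + 1) (Finset.mem_Icc.2 ⟨n.succ_pos, le_rfl⟩)]

theorem measurable_plainState [MeasurableSpace Z] (hg : Measurable (Function.uncurry g)) (n : ℕ) :
    Measurable (plainState g η ε x₁ n) := by
  induction n with
  | zero => exact measurable_const (a := (x₁, 0))
  | succ n ih =>
    have hx : Measurable fun u : ℕ → Z => (plainState g η ε x₁ n u).1 := ih.fst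
    have : Measurable fun u : ℕ → Z => (plainState g η ε x₁ n u).2 := ih.snd
    have : Measurable fun u : ℕ → Z => g (plainState g η ε x₁ n u).1 (u (n + 1)) :=
      hg.comp (hx.prodMk (measurable_pi_apply _))
    rw [funext (plainState_succ n)]
    unfold direction
    fun_prop

/-- The noise term of the descent inequality, scaled by `-c` and compensated by the bound
`noiseBound * weightedGradSq` on its square: the logarithm of one factor of the exponential
supermartingale. -/
def compensatedNoise (f : EuclideanSpace ℝ (Fin d) → ℝ)
    (g : EuclideanSpace ℝ (Fin d) → Z → EuclideanSpace ℝ (Fin d)) (B C ε c : ℝ)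
    (S : EuclideanSpace ℝ (Fin d) × EuclideanSpace ℝ (Fin d)) (w : Z) : ℝ :=
  -c * weightedNoise B C ε (gradient f S.1) S.2 (g S.1 w)
    - (-c) ^ 2 / 2 * (noiseBound B C ‖gradient f S.1‖ * weightedGradSq B C ε (gradient f S.1) S.2)

theorem neg_mul_sum_weightedNoise_le (hC₀ : 0 < C₀) {t : ℕ} {u : ℕ → Z} {M : ℝ}
    (h : pathSum (compensatedNoise f g B C ε (η / (3 * C₀))) (plainState g η ε x₁) t u ≤ M) :
    -(η * ∑ n ∈ Finset.range t, weightedNoise B C ε (gradient f (plainState g η ε x₁ n u).1)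
        (plainState g η ε x₁ n u).2 (g (plainState g η ε x₁ n u).1 (u (n + 1)))) ≤
      η ^ 2 / (6 * C₀) * ∑ n ∈ Finset.range t,
        noiseBound B C ‖gradient f (plainState g η ε x₁ n u).1‖
          * weightedGradSq B C ε (gradient f (plainState g η ε x₁ n u).1)
            (plainState g η ε x₁ n u).2
      + 3 * C₀ * M := by
  simp only [pathSum, compensatedNoise, Finset.sum_sub_distrib, ← Finset.mul_sum] at h
  refine sub_le_iff_le_add'.1 (le_trans (le_of_eq ?_)
    (mul_le_mul_of_nonneg_left h (by positivity : 0 ≤ 3 * C₀)))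
  field_simp
  ring

variable [MeasurableSpace Z] {P : Measure Z}

theorem measurable_compensatedNoise (hg : Measurable (Function.uncurry g))
    (hf : Measurable (gradient f)) :
    Measurable (Function.uncurry (compensatedNoise f g B C ε c)) := by
  have : Measurable fun q : (EuclideanSpace ℝ (Fin d) × EuclideanSpace ℝ (Fin d)) × Z =>
      g q.1.1 q.2 := hg.comp (measurable_fst.fst.prodMk measurable_snd)
  simp only [Function.uncurry_def, compensatedNoise, weightedNoise, weightedGradSq, weightedInner,
    proxyDenom, noiseBound]
  fun_prop

theorem lintegral_exp_compensatedNoise_le_one [IsProbabilityMeasure P] (hB : 0 ≤ B) (hC : 0 ≤ C)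
    (hε : 0 < ε) (hmean : UnbiasedOracle f g P) {x v : EuclideanSpace ℝ (Fin d)}
    (hnoise : ∀ᵐ w ∂P, ‖g x w - gradient f x‖ ^ 2 ≤ B * ‖gradient f x‖ ^ 2 + C)
    (hv : ∀ i, 0 ≤ v i) :
    ∫⁻ w, .ofReal (Real.exp (compensatedNoise f g B C ε c (x, v) w)) ∂P ≤ 1 := by
  obtain ⟨hint, hgrad⟩ := hmean x
  have hγ : AEMeasurable (g x) P := hint.aemeasurable
  refine lintegral_exp_mul_sub_le_one ?_
    (mul_nonneg (noiseBound_nonneg _ _ _) (weightedGradSq_nonneg hε))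
    (hnoise.mono fun w hw => sq_weightedNoise_le hε hB hC hv hw)
    (integral_weightedNoise_eq_zero hint hgrad) (-c)
  unfold weightedNoise weightedInner
  fun_prop

variable {Ω : Type*} [MeasurableSpace Ω] {μ : Measure Ω} [IsProbabilityMeasure μ] {T : ℕ}
  {z : ℕ → Ω → Z}

theorem measure_exists_lt_pathSum_compensatedNoise_le (hT : 1 ≤ T)
    (hz : IsIIDSample z (Finset.Icc 1 T) P μ) (hg : Measurable (Function.uncurry g))
    (hf : Measurable (gradient f)) (hB : 0 ≤ B) (hC : 0 ≤ C) (hε : 0 < ε)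
    (hmean : UnbiasedOracle f g P)
    (hnoise : ∀ x, ∀ᵐ w ∂P, ‖g x w - gradient f x‖ ^ 2 ≤ B * ‖gradient f x‖ ^ 2 + C)
    {δ : ℝ} (hδ : 0 < δ) :
    μ {ω | ∃ t ∈ Finset.Icc 1 T, Real.log (T / δ) <
      pathSum (compensatedNoise f g B C ε c) (plainState g η ε x₁) t (z · ω)} ≤
      ENNReal.ofReal δ := by
  have := hz.isProbabilityMeasure_law (Finset.mem_Icc.2 ⟨le_rfl, hT⟩)
  have hX := measurable_compensatedNoise (B := B) (C := C) (ε := ε) (c := c) hg hf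
  have hS := measurable_plainState (η := η) (ε := ε) (x₁ := x₁) hg
  have htail := measure_exists_log_card_div_lt_le (s := Finset.Icc 1 T) (μ := μ)
    (Y := fun t ω => pathSum (compensatedNoise f g B C ε c) (plainState g η ε x₁) t (z · ω))
    (fun t ht => hz.measurable_comp (Finset.Icc_subset_Icc_right (Finset.mem_Icc.1 ht).2)
      (measurable_pathSum hX hS t) (dependsOn_pathSum dependsOn_plainState t))
    (fun t ht => lintegral_exp_pathSum_le_one hz hX hS dependsOn_plainState
      (fun n u => lintegral_exp_compensatedNoise_le_one hB hC hε hmean (hnoise _)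
        (plainState_snd_nonneg n u)) (Finset.mem_Icc.1 ht).2) hδ
  simpa only [Nat.card_Icc, Nat.add_sub_cancel] using htail

theorem ae_forall_sq_norm_sub_gradient_le (hz : IsIIDSample z (Finset.Icc 1 T) P μ)
    (hg : Measurable (Function.uncurry g)) (hf : Measurable (gradient f))
    (hnoise : ∀ x, ∀ᵐ w ∂P, ‖g x w - gradient f x‖ ^ 2 ≤ B * ‖gradient f x‖ ^ 2 + C) :
    ∀ᵐ ω ∂μ, ∀ n < T, ‖g (plainState g η ε x₁ n (z · ω)).1 (z (n + 1) ω)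
        - gradient f (plainState g η ε x₁ n (z · ω)).1‖ ^ 2
      ≤ B * ‖gradient f (plainState g η ε x₁ n (z · ω)).1‖ ^ 2 + C := by
  refine ae_all_iff.2 fun n => Filter.eventually_imp_distrib_left.2 fun hn => ?_
  have : Measurable fun q : EuclideanSpace ℝ (Fin d) × Z => g q.1 q.2 := hg
  exact hz.ae_comp_prodMk (Finset.Icc_subset_Icc_right hn.le)
    (Finset.mem_Icc.2 ⟨n.succ_pos, hn⟩) (by simp) (measurable_plainState hg n).fst
    (fun u u' huu' => congrArg Prod.fst (dependsOn_plainState n huu'))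
    (p := fun q => ‖g q.1 q.2 - gradient f q.1‖ ^ 2 ≤ B * ‖gradient f q.1‖ ^ 2 + C)
    (measurableSet_le (by fun_prop) (by fun_prop)) hnoise

end Concentration

section Convergence

theorem calH_pos {L₀ L₁ B C Λ : ℝ} (hL₁ : 0 < L₁) (hB : 0 ≤ B) (hC : 0 ≤ C)
    (hΛ : 0 < Λ) : 0 < calH L₀ L₁ 0 B C Λ := by
  unfold calH
  positivity

theorem calL_pos {L₀ L₁ Λ : ℝ} (hL₀ : 0 < L₀) (hL₁ : 0 ≤ L₁) (hΛ : 0 ≤ Λ) :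
    0 < calL L₀ L₁ Λ := by
  unfold calL
  positivity

theorem le_min_step_size_iff {a C₀ H L L₁ η : ℝ} (hH : 0 < H) (hL : 0 < L)
    (ha : 0 < a) :
    η ≤ min C₀ (min (C₀ / H) (min (C₀ / L) (1 / (L₁ * a)))) ↔
      η ≤ C₀ ∧ η * H ≤ C₀ ∧ η * L ≤ C₀ ∧ η * a ≤ 1 / L₁ := by
  rw [le_min_iff, le_min_iff, le_min_iff, le_div_iff₀ hH, le_div_iff₀ hL, ← div_div,
    le_div_iff₀ ha]

theorem ofReal_one_sub_le_measure_of_ae_or {Ω : Type*} [MeasurableSpace Ω] {μ : Measure Ω}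
    [IsProbabilityMeasure μ] {good bad : Set Ω} {δ : ℝ} (hδ : 0 ≤ δ)
    (hbad : μ bad ≤ ENNReal.ofReal δ) (hcover : ∀ᵐ ω ∂μ, ω ∉ bad → ω ∈ good) :
    ENNReal.ofReal (1 - δ) ≤ μ good := by
  rw [ENNReal.ofReal_sub _ hδ, ENNReal.ofReal_one, tsub_le_iff_right]
  calc 1 = μ Set.univ := measure_univ.symm
    _ ≤ μ (good ∪ bad) := measure_mono_ae (hcover.mono fun ω hω _ => (or_iff_not_imp_right.2 hω))
    _ ≤ μ good + μ bad := measure_union_le _ _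
    _ ≤ μ good + ENNReal.ofReal δ := by gcongr

theorem sum_iterate_eq_sum_plainState {d : ℕ} {Z M : Type*} [AddCommMonoid M]
    (F : EuclideanSpace ℝ (Fin d) → M) (g : EuclideanSpace ℝ (Fin d) → Z → EuclideanSpace ℝ (Fin d))
    (η ε : ℝ) (x₁ : EuclideanSpace ℝ (Fin d)) (u : ℕ → Z) (T : ℕ) :
    ∑ s ∈ Finset.Icc 1 T, F (iterate g 0 η ε x₁ u s) =
      ∑ n ∈ Finset.range T, F (plainState g η ε x₁ n u).1 := by
  rw [Finset.range_eq_Ico, ← Finset.Ico_add_one_right_eq_Icc]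
  exact (Finset.sum_Ico_add' (fun s => F (iterate g 0 η ε x₁ u s)) 0 T 1).symm

theorem ofReal_one_sub_le_measure_mean_sq_norm_gradient_le {Ω Z : Type*} [MeasurableSpace Ω]
    [MeasurableSpace Z] {μ : Measure Ω} [IsProbabilityMeasure μ] {P : Measure Z} {d T : ℕ}
    {f : EuclideanSpace ℝ (Fin d) → ℝ} {fstar : ℝ}
    {g : EuclideanSpace ℝ (Fin d) → Z → EuclideanSpace ℝ (Fin d)} {z : ℕ → Ω → Z}
    {x₁ : EuclideanSpace ℝ (Fin d)} {L₀ L₁ B C C₀ η ε δ Y Λ : ℝ} (hT : 1 ≤ T)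
    (hδ : 0 < δ) (hδ1 : δ < 1) (hL₀ : 0 < L₀) (hL₁ : 0 < L₁) (hB : 0 ≤ B) (hC : 0 ≤ C)
    (hC₀ : 0 < C₀) (hη : 0 < η) (hε : 0 < ε) (hz : IsIIDSample z (Finset.Icc 1 T) P μ)
    (hg : Measurable (Function.uncurry g)) (hf : GeneralizedSmooth f L₀ L₁)
    (hb : BoundedBelowBy f fstar) (hmean : UnbiasedOracle f g P)
    (hnoise : ∀ x, ∀ᵐ w ∂P, ‖g x w - gradient f x‖ ^ 2 ≤ B * ‖gradient f x‖ ^ 2 + C)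
    (hY : LambdaY d T B C C₀ ε δ (f x₁ - fstar) ‖gradient f x₁‖ = Y) (hYΛ : Y ≤ Λ)
    (hηC₀ : η ≤ C₀) (hηH : η * calH L₀ L₁ 0 B C Λ ≤ C₀) (hηL : η * calL L₀ L₁ Λ ≤ C₀)
    (hηd : η * √d ≤ 1 / L₁) :
    ENNReal.ofReal (1 - δ) ≤
      μ {ω | (1 / T : ℝ) * ∑ s ∈ Finset.Icc 1 T,
            ‖gradient f (iterate g 0 η ε x₁ (fun n => z n ω) s)‖ ^ 2 ≤
          4 * Y / η *
            ((2 * Y * (B + 1) / η + calH L₀ L₁ 0 B C Λ + ε) / T + √(2 * C / T))} := by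
  have hgrad : Measurable (gradient f) := (hf.continuous_gradient hL₁).measurable
  refine ofReal_one_sub_le_measure_of_ae_or hδ.le
    (measure_exists_lt_pathSum_compensatedNoise_le (η := η) (c := η / (3 * C₀)) (x₁ := x₁)
      hT hz hg hgrad hB hC hε hmean hnoise hδ) ?_
  filter_upwards [ae_forall_sq_norm_sub_gradient_le (η := η) (ε := ε) (x₁ := x₁) hz hg hgrad hnoise]
    with ω hω hgood
  have hmart (t : ℕ) (ht : t ≤ T) : pathSum (compensatedNoise f g B C ε (η / (3 * C₀)))
      (plainState g η ε x₁) t (z · ω) ≤ Real.log (T / δ) := by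
    rcases t.eq_zero_or_pos with rfl | hpos
    · exact (log_div_pos hT hδ hδ1).le
    · exact not_lt.1 fun hlt => hgood ⟨t, Finset.mem_Icc.2 ⟨hpos, ht⟩, hlt⟩
  have htraj := isTrajectory_plainState (g := g) (u := (z · ω)) hω
  rw [sum_iterate_eq_sum_plainState (‖gradient f ·‖ ^ 2)]
  exact htraj.mean_sq_norm_gradient_le hf hb hT hL₀ hL₁ hB hC hC₀ hη hε hY hYΛ hηC₀ hηH hηL hηd
    fun t ht => neg_mul_sum_weightedNoise_le hC₀ (hmart t ht)

end Convergence

end AdaGrad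

end

theorem mainTheorem4 :
    -- order of `Λ_y`, with a universal constant
    (∃ c : ℝ, 0 < c ∧
      ∀ (d T : ℕ) (B C C₀ ε δ Δ₁ G : ℝ), 1 ≤ d → 1 ≤ T → 0 ≤ B → 0 ≤ C → 0 < C₀ → 0 < ε →
        0 < δ → δ < 1 → 0 ≤ Δ₁ → 0 ≤ G →
        AdaGrad.LambdaY d T B C C₀ ε δ Δ₁ G ≤
          c * (Δ₁ + (C₀ ^ 2 * d + C₀ * d) *
            (Real.log (T / δ + T / ε ^ 2)
              + Real.log (1 + (B + 1) * (G ^ 2 + C₀ ^ 2 * d) + C)))) ∧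
    -- order of `Λ_y` in `T, δ, ε, Δ₁`, with constants depending on the other parameters
    (∀ (d : ℕ) (B C C₀ G : ℝ), 1 ≤ d → 0 ≤ B → 0 ≤ C → 0 < C₀ → 0 ≤ G →
      ∃ k K : ℝ, 0 < k ∧ 0 < K ∧
        ∀ (T : ℕ) (ε δ Δ₁ : ℝ), 1 ≤ T → 0 < ε → 0 < δ → δ < 1 → 0 ≤ Δ₁ →
          k * (Δ₁ + C₀ ^ 2 * d * Real.log (T / δ + T / ε ^ 2)) ≤
              AdaGrad.LambdaY d T B C C₀ ε δ Δ₁ G ∧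
          AdaGrad.LambdaY d T B C C₀ ε δ Δ₁ G ≤
              K * (Δ₁ + C₀ ^ 2 * d * Real.log (T / δ + T / ε ^ 2))) ∧
    -- order of `Λ_x`
    (∀ L₀ L₁ C₀ : ℝ, 0 < L₀ → 0 < L₁ → 0 < C₀ →
      ∃ k K : ℝ, 0 < k ∧ 0 < K ∧
        ∀ (d T : ℕ) (B C ε δ Δ₁ G : ℝ), 1 ≤ d → 1 ≤ T → 0 ≤ B → 0 ≤ C → 0 < ε →
          0 < δ → δ < 1 → 0 ≤ Δ₁ → 0 ≤ G →
          k * AdaGrad.LambdaY d T B C C₀ ε δ Δ₁ G ^ 2 ≤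
              AdaGrad.LambdaX d T L₀ L₁ B C C₀ ε δ Δ₁ G ∧
          AdaGrad.LambdaX d T L₀ L₁ B C C₀ ε δ Δ₁ G ≤
              K * (AdaGrad.LambdaY d T B C C₀ ε δ Δ₁ G
                + AdaGrad.LambdaY d T B C C₀ ε δ Δ₁ G ^ 2) ∧
          (2 ≤ T → AdaGrad.LambdaX d T L₀ L₁ B C C₀ ε δ Δ₁ G ≤
              K * AdaGrad.LambdaY d T B C C₀ ε δ Δ₁ G ^ 2)) ∧
    -- the convergence bound
    (∀ (Ω : Type*) [MeasurableSpace Ω] (μ : Measure Ω) [IsProbabilityMeasure μ]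
      (Z : Type*) [MeasurableSpace Z] (P : Measure Z)
      (d T : ℕ) (f : EuclideanSpace ℝ (Fin d) → ℝ) (fstar : ℝ)
      (g : EuclideanSpace ℝ (Fin d) → Z → EuclideanSpace ℝ (Fin d))
      (z : ℕ → Ω → Z) (x₁ : EuclideanSpace ℝ (Fin d))
      (L₀ L₁ B C C₀ η ε δ Λy Λx H L : ℝ),
      1 ≤ d → 1 ≤ T → 0 < δ → δ < 1 →
      0 < L₀ → 0 < L₁ → 0 ≤ B → 0 ≤ C → 0 < C₀ → 0 < η → 0 < ε →
      -- the samples `z₁, …, z_T` are independent with law `P`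
      (∀ s ∈ Finset.Icc 1 T, Measurable (z s) ∧ μ.map (z s) = P) →
      iIndepFun (fun s : Finset.Icc 1 T => z s) μ →
      Measurable (Function.uncurry g) →
      AdaGrad.GeneralizedSmooth f L₀ L₁ →
      AdaGrad.BoundedBelowBy f fstar →
      AdaGrad.UnbiasedOracle f g P →
      AdaGrad.RelaxedAffineNoise f fstar g P 0 B C →
      Λy = AdaGrad.LambdaY d T B C C₀ ε δ (f x₁ - fstar) ‖gradient f x₁‖ →
      Λx = AdaGrad.LambdaX d T L₀ L₁ B C C₀ ε δ (f x₁ - fstar) ‖gradient f x₁‖ →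
      H = AdaGrad.calH L₀ L₁ 0 B C Λx →
      L = AdaGrad.calL L₀ L₁ Λx →
      η ≤ min C₀ (min (C₀ / H) (min (C₀ / L) (1 / (L₁ * Real.sqrt d)))) →
      ENNReal.ofReal (1 - δ) ≤
        μ {ω | (1 / T : ℝ) * ∑ s ∈ Finset.Icc 1 T,
              ‖gradient f (AdaGrad.iterate g 0 η ε x₁ (fun n => z n ω) s)‖ ^ 2 ≤
            4 * Λy / η *
              ((2 * Λy * (B + 1) / η + H + ε) / T + Real.sqrt (2 * C / T))}) := by
  refine ⟨⟨8, by norm_num, fun d T B C C₀ ε δ Δ₁ G hd hT hB hC hC₀ _ hδ hδ1 hΔ _ =>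
      AdaGrad.LambdaY_le_eight_mul hd hT hB hC hC₀.le hδ hδ1 hΔ⟩,
    fun d B C C₀ G hd hB hC hC₀ hG => ?_, fun L₀ L₁ C₀ hL₀ hL₁ hC₀ => ?_, ?_⟩
  · obtain ⟨k, K, hk, hK, h⟩ := AdaGrad.exists_LambdaY_bounds hd hB hC hC₀ hG
    exact ⟨k, K, hk, hK, fun T ε δ Δ₁ hT _ => h T ε δ Δ₁ hT⟩
  · obtain ⟨k, K, hk, hK, h⟩ := AdaGrad.exists_LambdaX_bounds hL₀.le hL₁ hC₀
    exact ⟨k, K, hk, hK, fun d T B C ε δ Δ₁ G _ hT hB hC _ hδ hδ1 hΔ _ =>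
      h d T B C ε δ Δ₁ G hT hB hC hδ hδ1 hΔ⟩
  · intro Ω _ μ _ Z _ P d T f fstar g z x₁ L₀ L₁ B C C₀ η ε δ Λy Λx H L hd hT hδ hδ1 hL₀ hL₁ hB hC
      hC₀ hη hε hz hind hg hf hb hmean hnoise hΛy hΛx hH hL hηle
    have hY : 0 < Λy :=
      hΛy ▸ AdaGrad.LambdaY_pos hT hB hC hC₀ hδ hδ1 (sub_nonneg.2 (hb x₁))
    have hYX : Λy + 8 * L₁ * Λy ^ 2 ≤ Λx := by
      subst hΛy hΛx
      exact AdaGrad.LambdaY_add_sq_le_LambdaX hL₀.le hB hC hY.le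
    have hΛ : Λy ≤ Λx := (le_add_of_nonneg_right (by positivity)).trans hYX
    subst hH hL
    obtain ⟨hηC₀, hηH, hηL, hηd⟩ := (AdaGrad.le_min_step_size_iff
      (AdaGrad.calH_pos hL₁ hB hC (hY.trans_le hΛ))
      (AdaGrad.calL_pos hL₀ hL₁.le (hY.le.trans hΛ))
      (Real.sqrt_pos.2 (Nat.cast_pos.2 hd))).1 hηle
    exact AdaGrad.ofReal_one_sub_le_measure_mean_sq_norm_gradient_le hT hδ hδ1 hL₀ hL₁ hB hC hC₀
      hη hε ⟨fun s hs => (hz s hs).1, fun s hs => (hz s hs).2, hind⟩ hg hf hb hmean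
      (by simpa only [AdaGrad.RelaxedAffineNoise, zero_mul, zero_add] using hnoise) hΛy.symm hΛ
      hηC₀ hηH hηL hηd
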